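/- Let $\langle v,w\rangle=v_1w_1+v_2w_2-v_3w_3$ on $\mathbb R^3$, let $\mathbb H^2=\{p:\langle p,p\rangle=-1,\ p_3>0\}$ be the hyperbolic plane, and let $G=\mathrm{Isom}(\mathbb H^2)$, acting linearly on $\mathbb R^3$, with Lie algebra $\mathfrak g=\mathfrak{so}(2,1)$. A future-pointing light-like vector $v$ represents the ideal point $[v]$ decorated with the open horoball $\{p\in\mathbb H^2:\langle p,v\rangle>-1\}$. A *decorated metric* $m=[\rho,\mathbf x,\mathbf h]$ on a crowned hyperbolic surface $S$ with $Q\ge 1$ decorated spikes (orientable or not; $Q\geq 3$ if $S$ is an ideal polygon) is given by a faithful representation $\rho$ of the finitely generated free group $\pi_1(S)$ into $G$, with discrete image all of whose non-trivial elements are hyperbolic (translations or glide reflections along geodesics), and by future-pointing light-like vectors $v_1,\dots,v_Q$ representing the spikes $x_i$ with their horoballs $h_i$, such that the $[v_i]$ lie outside the limit set of $\rho(\pi_1(S))$ and in pairwise distinct $\rho(\pi_1(S))$-orbits; all up to the action of $G$. The universal cover of $S$ is the convex hull of the limit set and of the orbits of the $[v_i]$. The tangent space $T_m$ of the deformation space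 at $m$ (the space of *infinitesimal deformations* of $m$) is the space of pairs $(u,(w_i)_i)$, where $u:\pi_1(S)\to\mathfrak g$ satisfies $u(\gamma\delta)=u(\gamma)+\mathrm{Ad}(\rho(\gamma))u(\delta)$ and $w_i\in\mathbb R^3$ satisfies $\langle w_i,v_i\rangle=0$, modulo the pairs $\bigl((X-\mathrm{Ad}(\rho(\gamma))X)_\gamma,(Xv_i)_i\bigr)$ with $X\in\mathfrak g$. Fix any norm $\|\cdot\|$ on $T_m$. A *horoball connection* $\beta$ of $S$ is the image in $S$ of a geodesic of $\mathbb H^2$ joining two distinct lifts $[\rho(\gamma)v_i]$, $[\rho(\delta)v_j]$ of decorated spikes. Its (signed) length is $l_\beta(m)=\ln\bigl(-\tfrac12\langle \rho(\gamma)v_i,\rho(\delta)v_j\rangle\bigr)$, and $\mathrm dl_\beta(m):T_m\to\mathbb R$ is the differential of this length function. **Theorem.** For every decorated metric $m$ there is a constant $K>0$ such that for every infinitesimal deformation $u\in T_m$ and every horoball connection $\beta$ with $l_\beta(m)>0$ (hence for every horoball connection, if the closures of the decorating horoballs and of all their lifts are pairwise disjoint), $$|\mathrm dl_\beta(m)(u)|\le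 K\,l_\beta(m)\,\|u\|.$$ -/

import Mathlib

open Filter Topology Matrix

noncomputable section

/-- The bilinear form of signature `(2,1)` on `ℝ³`. -/
def minkowski (v w : Fin 3 → ℝ) : ℝ := v 0 * w 0 + v 1 * w 1 - v 2 * w 2

/-- The hyperbolic plane, as the upper sheet of the hyperboloid `⟨p,p⟩ = -1`. -/
def hyperbolicPlane : Set (Fin 3 → ℝ) := {p | minkowski p p = -1 ∧ 0 < p 2}

/-- The future-pointing light-like vectors. The vector `v` stands for the ideal point `[v]`
decorated with the open horoball `{p ∈ ℍ² | ⟨p,v⟩ > -1}` based at `[v]`; this is a bijection between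
`positiveLightCone` and the set of all horoballs of `ℍ²`. -/
def positiveLightCone : Set (Fin 3 → ℝ) := {v | minkowski v v = 0 ∧ 0 < v 2}

/-- The full isometry group of the hyperbolic plane (orientation-reversing isometries included;
it is isomorphic to `PGL(2,ℝ)` and to `SO(2,1)`), as the group of linear automorphisms
of `ℝ³` that preserve the form and the upper sheet of the hyperboloid. -/
def isometryGroup : Subgroup (GL (Fin 3) ℝ) where
  carrier := {g | (∀ v w, minkowski (g.1 *ᵥ v) (g.1 *ᵥ w) = minkowski v w) ∧
    ∀ p ∈ hyperbolicPlane, g.1 *ᵥ p ∈ hyperbolicPlane}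
  one_mem' := by simp
  mul_mem' := by
    rintro a b ⟨ha, ha'⟩ ⟨hb, hb'⟩
    refine ⟨fun v w => ?_, fun p hp => ?_⟩
    · rw [Units.val_mul, ← mulVec_mulVec, ← mulVec_mulVec, ha, hb]
    · rw [Units.val_mul, ← mulVec_mulVec]
      exact ha' _ (hb' _ hp)
  inv_mem' := by
    rintro a ⟨ha, ha'⟩
    have key : ∀ v, a.1 *ᵥ ((a⁻¹).1 *ᵥ v) = v := fun v => by
      rw [mulVec_mulVec, ← Units.val_mul]; simp
    refine ⟨fun v w => ?_, fun p hp => ?_⟩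
    · rw [← ha, key, key]
    · set q := (a⁻¹).1 *ᵥ p with hq
      have h1 : minkowski q q = -1 := by rw [← ha, hq, key]; exact hp.1
      refine ⟨h1, ?_⟩
      by_contra hneg
      have h2 : q 2 ≠ 0 := by
        intro h0
        simp only [minkowski, h0] at h1
        nlinarith [sq_nonneg (q 0), sq_nonneg (q 1)]
      have h3 : -q ∈ hyperbolicPlane := by
        refine ⟨?_, ?_⟩
        · simp only [minkowski, Pi.neg_apply] at h1 ⊢
          linarith
        · simp only [Pi.neg_apply]
          rcases lt_or_gt_of_ne h2 with h | h
          · linarith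
          · exact absurd h hneg
      have h4 := (ha' _ h3).2
      rw [mulVec_neg, hq, key] at h4
      have h5 := hp.2
      simp only [Pi.neg_apply] at h4
      linarith

/-- An isometry is hyperbolic if it is a translation of positive length along a geodesic, possibly
composed with the reflection in that geodesic (glide reflection). Equivalently it multiplies
some future-pointing light-like vector by a factor `> 1`. -/
def IsHyperbolicIsometry (g : isometryGroup) : Prop :=
  ∃ c : ℝ, 1 < c ∧ ∃ p ∈ positiveLightCone, (g : GL (Fin 3) ℝ).1 *ᵥ p = c • p

/-- The point `[v]` of the closed unit disk (projective model), for a future-pointing causal `v`. -/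
def kleinPoint (v : Fin 3 → ℝ) : ℝ × ℝ := (v 0 / v 2, v 1 / v 2)

/-- `[v]` is a limit point of a representation `ρ` with values in the isometry group: it is an
accumulation point, in the closed disk, of the orbit `γ ↦ ρ(γ) o` of the point `o = (0,0,1)`. -/
def IsLimitPoint {π : Type*} [Group π] (ρ : π →* isometryGroup) (v : Fin 3 → ℝ) : Prop :=
  MapClusterPt (kleinPoint v) cofinite
    (fun γ : π => kleinPoint ((ρ γ : GL (Fin 3) ℝ).1 *ᵥ ![0, 0, 1]))

/-- A decorated metric `(ρ, x, h)` on a crowned hyperbolic surface with fundamental group `π`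
(free of finite rank) and with spikes labelled by `ι`.

The holonomy `ρ` is faithful with discrete image consisting of hyperbolic elements (and `1`). The
lift of the `i`-th spike `xᵢ` and its horoball `hᵢ` are recorded by one future-pointing light-like
vector. The spikes lie outside of the limit set, that is, in the intervals of the circle at infinity
cut off by the axes of the peripheral elements on the sides away from the convex core; distinct
spikes have distinct orbits. The universal cover of the surface is the convex hull in `ℍ²`
of the limit set and of the orbits of all `xᵢ`, the surface is its quotient by `ρ(π)`.
A simply connected surface is an ideal polygon and has at least three spikes. -/
structure DecoratedMetric (π ι : Type*) [Group π] [Fintype ι] where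
  hol : π →* isometryGroup
  hol_injective : Function.Injective hol
  hol_discrete : DiscreteTopology hol.range
  hol_hyperbolic : ∀ γ : π, γ ≠ 1 → IsHyperbolicIsometry (hol γ)
  nonempty_spikes : Nonempty ι
  spike : ι → Fin 3 → ℝ
  spike_mem : ∀ i, spike i ∈ positiveLightCone
  spike_not_limit : ∀ i, ¬ IsLimitPoint hol (spike i)
  spike_distinct : ∀ (i j : ι) (γ : π) (c : ℝ),
    (hol γ : GL (Fin 3) ℝ).1 *ᵥ spike i = c • spike j → i = j
  polygon_spikes : Subsingleton π → 3 ≤ Fintype.card ι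

/-- The Lie algebra `so(2,1)` of the isometry group. -/
def isometryAlgebra : Submodule ℝ (Matrix (Fin 3) (Fin 3) ℝ) where
  carrier := {X | ∀ v w, minkowski (X *ᵥ v) w + minkowski v (X *ᵥ w) = 0}
  zero_mem' := by intro v w; simp [minkowski]
  add_mem' := by
    intro X Y hX hY v w
    have h1 := hX v w
    have h2 := hY v w
    simp only [minkowski, add_mulVec, Pi.add_apply] at *
    linarith
  smul_mem' := by
    intro c X hX v w
    have h1 := hX v w
    simp only [minkowski, smul_mulVec, Pi.smul_apply, smul_eq_mul] at *
    linear_combination c * h1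

/-- A horoball connection, given by a lift: the geodesic of `ℍ²` joining two distinct lifts of
decorated spikes, where `(γ, i)` denotes the lift `ρ(γ) xᵢ` of the `i`-th spike. Pairs in
the same `π`-orbit represent the same horoball connection of the surface. -/
structure HoroballConnection (π ι : Type*) where
  source : π × ι
  target : π × ι
  ne : source ≠ target

namespace DecoratedMetric

variable {π ι : Type*} [Group π] [Fintype ι] (m : DecoratedMetric π ι)

/-- The matrix of `ρ(γ)`. -/
def holMatrix (γ : π) : Matrix (Fin 3) (Fin 3) ℝ := (m.hol γ : GL (Fin 3) ℝ).1

/-- The light-like vector of the lift `(γ, i)` of the `i`-th decorated spike. -/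
def lift (a : π × ι) : Fin 3 → ℝ := m.holMatrix a.1 *ᵥ m.spike a.2

/-- The (signed) length `ln (-⟨v₁,v₂⟩/2)` of a horoball connection. -/
def length (β : HoroballConnection π ι) : ℝ :=
  Real.log (-(minkowski (m.lift β.source) (m.lift β.target)) / 2)

/-- Tangent vectors at `(ρ, (vᵢ))` to the space of pairs of a representation and a family of
future-pointing light-like vectors: a `ρ`-cocycle `u` with values in the Lie algebra (a path `ρₜ` has
the velocity `ρₜ(γ)' = u(γ) ρ(γ)`), and vectors `wᵢ` tangent to the light cone at `vᵢ`. -/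
def cocycles : Submodule ℝ ((π → Matrix (Fin 3) (Fin 3) ℝ) × (ι → Fin 3 → ℝ)) where
  carrier := {z | (∀ γ, z.1 γ ∈ isometryAlgebra) ∧
    (∀ γ δ, z.1 (γ * δ) = z.1 γ + m.holMatrix γ * z.1 δ * m.holMatrix γ⁻¹) ∧
    ∀ i, minkowski (z.2 i) (m.spike i) = 0}
  zero_mem' := by
    refine ⟨fun γ => isometryAlgebra.zero_mem, fun γ δ => by simp, fun i => by simp [minkowski]⟩
  add_mem' := by
    rintro a b ⟨a1, a2, a3⟩ ⟨b1, b2, b3⟩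
    refine ⟨fun γ => isometryAlgebra.add_mem (a1 γ) (b1 γ), fun γ δ => ?_, fun i => ?_⟩
    · simp only [Prod.fst_add, Pi.add_apply, a2, b2, mul_add, add_mul]
      abel
    · have h1 := a3 i
      have h2 := b3 i
      simp only [minkowski, Prod.snd_add, Pi.add_apply] at *
      linarith
  smul_mem' := by
    rintro c a ⟨a1, a2, a3⟩
    refine ⟨fun γ => isometryAlgebra.smul_mem c (a1 γ), fun γ δ => ?_, fun i => ?_⟩
    · simp only [Prod.smul_fst, Pi.smul_apply, a2, smul_add, mul_smul_comm, smul_mul_assoc]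
    · have h1 := a3 i
      simp only [minkowski, Prod.smul_snd, Pi.smul_apply, smul_eq_mul] at *
      linear_combination c * h1

theorem holMatrix_mul (γ δ : π) : m.holMatrix (γ * δ) = m.holMatrix γ * m.holMatrix δ := by
  simp [holMatrix]

theorem holMatrix_inv_mul (γ : π) : m.holMatrix γ⁻¹ * m.holMatrix γ = 1 := by
  rw [← holMatrix_mul, inv_mul_cancel]; simp [holMatrix]

theorem minkowski_holMatrix (γ : π) (v w : Fin 3 → ℝ) :
    minkowski (m.holMatrix γ *ᵥ v) (m.holMatrix γ *ᵥ w) = minkowski v w :=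
  (m.hol γ).2.1 v w

theorem minkowski_holMatrix_inv (γ : π) (v w : Fin 3 → ℝ) :
    minkowski (m.holMatrix γ *ᵥ v) w = minkowski v (m.holMatrix γ⁻¹ *ᵥ w) := by
  rw [← m.minkowski_holMatrix γ⁻¹, mulVec_mulVec, holMatrix_inv_mul, one_mulVec]

theorem conj_mem (γ : π) {X : Matrix (Fin 3) (Fin 3) ℝ} (hX : X ∈ isometryAlgebra) :
    m.holMatrix γ * X * m.holMatrix γ⁻¹ ∈ isometryAlgebra := by
  intro v w
  have h := hX (m.holMatrix γ⁻¹ *ᵥ v) (m.holMatrix γ⁻¹ *ᵥ w)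
  have h2 := m.minkowski_holMatrix_inv γ⁻¹ v (X *ᵥ (m.holMatrix γ⁻¹ *ᵥ w))
  rw [inv_inv] at h2
  rw [← mulVec_mulVec, ← mulVec_mulVec, ← mulVec_mulVec, ← mulVec_mulVec,
    minkowski_holMatrix_inv, ← h2, h]

/-- The velocity at `g = 1` of the action of the isometry group by simultaneous conjugation of the
representation and motion of the horoballs: `X ↦ (γ ↦ X - Ad(ρ(γ)) X, (X vᵢ)ᵢ)`. -/
def orbitVelocity : isometryAlgebra →ₗ[ℝ] m.cocycles where
  toFun X := ⟨(fun γ => X.1 - m.holMatrix γ * X.1 * m.holMatrix γ⁻¹, fun i => X.1 *ᵥ m.spike i), by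
    refine ⟨fun γ => isometryAlgebra.sub_mem X.2 (m.conj_mem γ X.2), fun γ δ => ?_, fun i => ?_⟩
    · simp only [_root_.mul_inv_rev, holMatrix_mul, mul_sub, sub_mul, mul_assoc]
      abel
    · have h := X.2 (m.spike i) (m.spike i)
      simp only [minkowski] at *
      linarith⟩
  map_add' X Y := by
    ext1
    refine Prod.ext (funext fun γ => ?_) (funext fun i => ?_)
    · simp only [Submodule.coe_add, Prod.fst_add, Pi.add_apply, mul_add, add_mul]
      abel
    · simp only [Submodule.coe_add, Prod.snd_add, Pi.add_apply, add_mulVec]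
  map_smul' c X := by
    ext1
    refine Prod.ext (funext fun γ => ?_) (funext fun i => ?_)
    · simp [smul_sub]
    · simp [smul_mulVec]

/-- Infinitesimal deformations of the decorated metric `[ρ, x, h]`: the tangent space at `m` of the
deformation space, that is, of the space of pairs `(ρ, (vᵢ))` modulo the isometry group. -/
abbrev InfinitesimalDeformation : Type _ := m.cocycles ⧸ LinearMap.range m.orbitVelocity

/-- The velocity of the lift `(γ, i)` of the `i`-th decorated spike, that is, of `ρ(γ) vᵢ`. -/
def liftVelocity (z : m.cocycles) (a : π × ι) : Fin 3 → ℝ :=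
  z.1.1 a.1 *ᵥ m.lift a + m.holMatrix a.1 *ᵥ z.1.2 a.2

/-- The derivative of the length of `β` in the direction of a pair `(u, w)`. -/
def dlengthCocycle (β : HoroballConnection π ι) : m.cocycles →ₗ[ℝ] ℝ where
  toFun z := (minkowski (m.liftVelocity z β.source) (m.lift β.target) +
    minkowski (m.lift β.source) (m.liftVelocity z β.target)) /
      minkowski (m.lift β.source) (m.lift β.target)
  map_add' y z := by
    rw [← add_div]
    congr 1
    simp only [liftVelocity, Submodule.coe_add, Prod.fst_add, Prod.snd_add, Pi.add_apply,
      add_mulVec, mulVec_add, minkowski]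
    ring
  map_smul' c z := by
    rw [RingHom.id_apply, smul_eq_mul, ← mul_div_assoc]
    congr 1
    simp only [liftVelocity, Submodule.coe_smul, Prod.smul_fst, Prod.smul_snd, Pi.smul_apply,
      smul_mulVec, mulVec_smul, minkowski, Pi.add_apply, smul_eq_mul]
    ring

theorem liftVelocity_orbitVelocity (X : isometryAlgebra) (a : π × ι) :
    m.liftVelocity (m.orbitVelocity X) a = X.1 *ᵥ m.lift a := by
  have h : m.holMatrix a.1⁻¹ *ᵥ m.lift a = m.spike a.2 := by
    rw [lift, mulVec_mulVec, holMatrix_inv_mul, one_mulVec]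
  simp only [liftVelocity, orbitVelocity, LinearMap.coe_mk, AddHom.coe_mk, sub_mulVec]
  rw [← mulVec_mulVec, ← mulVec_mulVec, h, sub_add_cancel]

/-- The differential at `m` of the length function of `β`. -/
def dlength (β : HoroballConnection π ι) : m.InfinitesimalDeformation →ₗ[ℝ] ℝ :=
  (LinearMap.range m.orbitVelocity).liftQ (m.dlengthCocycle β) (by
    rintro _ ⟨X, rfl⟩
    rw [LinearMap.mem_ker]
    have h := X.2 (m.lift β.source) (m.lift β.target)
    simp only [dlengthCocycle, LinearMap.coe_mk, AddHom.coe_mk, liftVelocity_orbitVelocity]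
    rw [h, zero_div])

/-- `dlength` is the differential of `length`: along every path of decorated metrics through `m`
with velocity `z`, the length of `β` has the derivative `dlength β [z]`. -/
theorem hasDerivAt_length (β : HoroballConnection π ι) (hβ : m.length β ≠ 0)
    (path : ℝ → DecoratedMetric π ι) (h0 : path 0 = m) (z : m.cocycles)
    (hhol : ∀ γ i j, HasDerivAt (fun t => (path t).holMatrix γ i j)
      ((z.1.1 γ * m.holMatrix γ) i j) 0)
    (hspike : ∀ i j, HasDerivAt (fun t => (path t).spike i j) (z.1.2 i j) 0) :
    HasDerivAt (fun t => (path t).length β) (m.dlength β (Submodule.Quotient.mk z)) 0 := by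
  have hl : ∀ (a : π × ι) (j : Fin 3),
      HasDerivAt (fun t => (path t).lift a j) (m.liftVelocity z a j) 0 := by
    intro a j
    have h := HasDerivAt.fun_sum (u := Finset.univ) (fun k (_ : k ∈ Finset.univ) =>
      (hhol a.1 j k).mul (hspike a.2 k))
    refine h.congr_deriv ?_
    rw [liftVelocity, lift, mulVec_mulVec]
    simp only [Pi.add_apply, mulVec, dotProduct, h0, ← Finset.sum_add_distrib]
  have hm : HasDerivAt (fun t => minkowski ((path t).lift β.source) ((path t).lift β.target))
      (minkowski (m.liftVelocity z β.source) (m.lift β.target) +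
        minkowski (m.lift β.source) (m.liftVelocity z β.target)) 0 := by
    have h := (((hl β.source 0).mul (hl β.target 0)).add
      ((hl β.source 1).mul (hl β.target 1))).sub ((hl β.source 2).mul (hl β.target 2))
    refine h.congr_deriv ?_
    simp only [minkowski, h0]
    ring
  have hne : minkowski (m.lift β.source) (m.lift β.target) ≠ 0 := by
    intro h
    apply hβ
    simp [length, h]
  have h := (hm.fun_neg.div_const 2).log (by simpa [h0] using hne)
  refine h.congr_deriv ?_
  rw [dlength, ← Submodule.mkQ_apply, ← LinearMap.comp_apply, Submodule.liftQ_mkQ]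
  simp only [dlengthCocycle, LinearMap.coe_mk, AddHom.coe_mk, h0]
  field_simp

end DecoratedMetric

end

/-! Up to the action of the group, a horoball connection joins the spike `v_i` to `ρ(γ)v_j`, and its
length is the logarithm of `-⟨v_i, ρ(γ)v_j⟩/2`. Put `A(γ) = coshDisp γ`, the hyperbolic cosine of
the displacement of a base point. Since the spikes avoid the limit set, this product is at least a
multiple of `A(γ)` for all but finitely many `γ` (`exists_spike_lower`), so the length is at least
`log A(γ)` up to an additive constant.

The derivative of the product is dominated by `⟨v_i, u(γ)ρ(γ)v_j⟩`. Write `γ` as the end of a chain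
`p_0 = 1, ..., p_n = γ` with steps in a finite set. The cocycle relation makes `u(γ)` a sum of `n`
conjugated increments, and the `k`-th one contributes at most a multiple of `A(p_k)A(p_k⁻¹γ)`. If
the chain follows a geodesic, this is at most a multiple of `A(γ)`, and `n` is at most linear in `1
+ log A(γ)`. Dividing by the product bounds `dl` by a multiple of `1 + log A(γ)`, hence of `l`
outside finitely many pairs. The tangent space has finite dimension, so a bound for each vector
gives a uniform one (`exists_uniform_bound`).

The substance is the existence of such chains, `exists_chain`: a finitely generated discrete group
without parabolics is convex cocompact. Join points of the orbit of one spike by the edges of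
minimal spanning trees for `λ`-lengths. By Ptolemy's theorem these edges do not cross, and the graph
is invariant, locally finite and connected. Take a shortest path from `1` to `γ`. A vertex with an
edge crossing the geodesic from `1` to `γ` is close to this geodesic, by Ptolemy again. Between such
vertices the path always turns to the neighbouring edge in the same direction
(`turns_of_noncrossing`), so it becomes periodic after bounded time (`periodic_of_turns`). It then
follows powers of a hyperbolic element, which are undistorted (`exists_cyclic_bound`), and therefore
stays close to the geodesic as well. -/

noncomputable section

/-! ### Spinor coordinates, `λ`-lengths and Ptolemy's theorem -/

/-- The determinant of three vectors of `ℝ³`. -/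
def orient (a b c : Fin 3 → ℝ) : ℝ :=
  a 0 * (b 1 * c 2 - b 2 * c 1) - a 1 * (b 0 * c 2 - b 2 * c 0) + a 2 * (b 0 * c 1 - b 1 * c 0)

/-- Penner's `λ`-length of a pair of light-like vectors, up to the factor `√2`. -/
def lam (a b : Fin 3 → ℝ) : ℝ := √(-minkowski a b)

theorem orient_swap_left (a b c : Fin 3 → ℝ) : orient b a c = -orient a b c := by
  simp only [orient]; ring

theorem orient_swap_right (a b c : Fin 3 → ℝ) : orient a c b = -orient a b c := by
  simp only [orient]; ring

theorem orient_mulVec (M : Matrix (Fin 3) (Fin 3) ℝ) (a b c : Fin 3 → ℝ) :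
    orient (M *ᵥ a) (M *ᵥ b) (M *ᵥ c) = M.det * orient a b c := by
  simp only [orient, det_fin_three, mulVec, dotProduct, Fin.sum_univ_three]; ring

theorem minkowski_comm (a b : Fin 3 → ℝ) : minkowski a b = minkowski b a := by
  simp only [minkowski]; ring

theorem lam_comm (a b : Fin 3 → ℝ) : lam a b = lam b a := by
  rw [lam, lam, minkowski_comm]

theorem lam_nonneg (a b : Fin 3 → ℝ) : 0 ≤ lam a b := Real.sqrt_nonneg _

/-- The light-like vector with the given spinor coordinates. -/
def spin (x y : ℝ) : Fin 3 → ℝ := ![x ^ 2 - y ^ 2, 2 * x * y, x ^ 2 + y ^ 2]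

theorem exists_spin {v : Fin 3 → ℝ} (hv : v ∈ positiveLightCone) : ∃ q : ℝ × ℝ, v = spin q.1 q.2 := by
  obtain ⟨h1, h2⟩ := hv
  simp only [minkowski] at h1
  have hp : 0 ≤ (v 2 + v 0) / 2 := by nlinarith [sq_nonneg (v 1)]
  have hm : 0 ≤ (v 2 - v 0) / 2 := by nlinarith [sq_nonneg (v 1)]
  have hmul : √((v 2 + v 0) / 2) * √((v 2 - v 0) / 2) = |v 1| / 2 := by
    rw [← Real.sqrt_mul hp, show (v 2 + v 0) / 2 * ((v 2 - v 0) / 2) = (v 1 / 2) ^ 2 by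
      linear_combination -h1 / 4, Real.sqrt_sq_eq_abs, abs_div, abs_two]
  have hx := Real.sq_sqrt hp
  have hy := Real.sq_sqrt hm
  generalize √((v 2 + v 0) / 2) = x at *
  generalize √((v 2 - v 0) / 2) = y at *
  rcases le_total 0 (v 1) with h | h
  · rw [abs_of_nonneg h] at hmul
    refine ⟨(x, y), funext fun i => ?_⟩
    fin_cases i <;> simp [spin] <;> linarith
  · rw [abs_of_nonpos h] at hmul
    refine ⟨(x, -y), funext fun i => ?_⟩
    fin_cases i <;> simp [spin] <;> linarith

/-- A light-like vector is the square of a spinor. Hence `λ`-lengths are, up to `√2`, absolute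
values of plane determinants, and `orient` is a product of three such determinants. -/
theorem minkowski_spin (x y x' y' : ℝ) :
    minkowski (spin x y) (spin x' y') = -2 * (x * y' - y * x') ^ 2 := by
  simp [minkowski, spin]; ring

theorem orient_spin (x y x' y' x'' y'' : ℝ) : orient (spin x y) (spin x' y') (spin x'' y'') =
    4 * ((x * y' - y * x') * (x' * y'' - y' * x'') * (x'' * y - y'' * x)) * (-1) := by
  simp [orient, spin]; ring

theorem minkowski_nonpos {a b : Fin 3 → ℝ} (ha : a ∈ positiveLightCone)
    (hb : b ∈ positiveLightCone) : minkowski a b ≤ 0 := by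
  obtain ⟨p, rfl⟩ := exists_spin ha
  obtain ⟨q, rfl⟩ := exists_spin hb
  rw [minkowski_spin]
  nlinarith [sq_nonneg (p.1 * q.2 - p.2 * q.1)]

theorem lam_sq {a b : Fin 3 → ℝ} (ha : a ∈ positiveLightCone) (hb : b ∈ positiveLightCone) :
    lam a b ^ 2 = -minkowski a b :=
  Real.sq_sqrt (neg_nonneg.2 (minkowski_nonpos ha hb))

theorem lam_spin (x y x' y' : ℝ) : lam (spin x y) (spin x' y') = √2 * |x * y' - y * x'| := by
  rw [lam, minkowski_spin, ← Real.sqrt_sq_eq_abs, ← Real.sqrt_mul (by norm_num)]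
  congr 1; ring

/-- **Ptolemy's inequality** for `λ`-lengths. -/
theorem lam_ptolemy_le {a b c d : Fin 3 → ℝ} (ha : a ∈ positiveLightCone)
    (hb : b ∈ positiveLightCone) (hc : c ∈ positiveLightCone) (hd : d ∈ positiveLightCone) :
    lam a c * lam b d ≤ lam a b * lam c d + lam b c * lam a d := by
  obtain ⟨a, rfl⟩ := exists_spin ha
  obtain ⟨b, rfl⟩ := exists_spin hb
  obtain ⟨c, rfl⟩ := exists_spin hc
  obtain ⟨d, rfl⟩ := exists_spin hd
  have h2 : (√2 : ℝ) * √2 = 2 := Real.mul_self_sqrt (by norm_num)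
  have key := abs_add_le ((a.1 * b.2 - a.2 * b.1) * (c.1 * d.2 - c.2 * d.1))
    ((b.1 * c.2 - b.2 * c.1) * (a.1 * d.2 - a.2 * d.1))
  -- Plücker's relation among the six determinants of four plane vectors; Ptolemy's inequality is
  -- its absolute value.
  rw [show (a.1 * b.2 - a.2 * b.1) * (c.1 * d.2 - c.2 * d.1) +
    (b.1 * c.2 - b.2 * c.1) * (a.1 * d.2 - a.2 * d.1) =
    (a.1 * c.2 - a.2 * c.1) * (b.1 * d.2 - b.2 * d.1) by ring, abs_mul, abs_mul, abs_mul] at key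
  simp only [lam_spin]
  linear_combination 2 * key + (|a.1 * c.2 - a.2 * c.1| * |b.1 * d.2 - b.2 * d.1| -
    |a.1 * b.2 - a.2 * b.1| * |c.1 * d.2 - c.2 * d.1| -
    |b.1 * c.2 - b.2 * c.1| * |a.1 * d.2 - a.2 * d.1|) * h2

/-- **Ptolemy's theorem** for `λ`-lengths: equality holds if the geodesics `ac` and `bd` cross. -/
theorem lam_ptolemy_eq {a b c d : Fin 3 → ℝ} (ha : a ∈ positiveLightCone)
    (hb : b ∈ positiveLightCone) (hc : c ∈ positiveLightCone) (hd : d ∈ positiveLightCone)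
    (h : orient a c b * orient a c d < 0) :
    lam a c * lam b d = lam a b * lam c d + lam b c * lam a d := by
  obtain ⟨a, rfl⟩ := exists_spin ha
  obtain ⟨b, rfl⟩ := exists_spin hb
  obtain ⟨c, rfl⟩ := exists_spin hc
  obtain ⟨d, rfl⟩ := exists_spin hd
  have h2 : (√2 : ℝ) * √2 = 2 := Real.mul_self_sqrt (by norm_num)
  -- Crossing means that the two summands of Plücker's relation have the same sign, so the triangle
  -- inequality is an equality.
  have hpos : 0 < ((a.1 * b.2 - a.2 * b.1) * (c.1 * d.2 - c.2 * d.1)) *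
      ((b.1 * c.2 - b.2 * c.1) * (a.1 * d.2 - a.2 * d.1)) := by
    rw [orient_spin, orient_spin] at h
    by_contra hneg
    nlinarith [mul_nonneg (sq_nonneg (a.1 * c.2 - a.2 * c.1)) (sub_nonneg.2 (not_lt.1 hneg))]
  have key : |(a.1 * b.2 - a.2 * b.1) * (c.1 * d.2 - c.2 * d.1) +
    (b.1 * c.2 - b.2 * c.1) * (a.1 * d.2 - a.2 * d.1)| =
    |(a.1 * b.2 - a.2 * b.1) * (c.1 * d.2 - c.2 * d.1)| +
    |(b.1 * c.2 - b.2 * c.1) * (a.1 * d.2 - a.2 * d.1)| := by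
    rw [abs_add_eq_add_abs_iff]
    rcases pos_and_pos_or_neg_and_neg_of_mul_pos hpos with h | h
    · exact Or.inl ⟨h.1.le, h.2.le⟩
    · exact Or.inr ⟨h.1.le, h.2.le⟩
  rw [show (a.1 * b.2 - a.2 * b.1) * (c.1 * d.2 - c.2 * d.1) +
    (b.1 * c.2 - b.2 * c.1) * (a.1 * d.2 - a.2 * d.1) =
    (a.1 * c.2 - a.2 * c.1) * (b.1 * d.2 - b.2 * d.1) by ring, abs_mul, abs_mul, abs_mul] at key
  simp only [lam_spin]
  linear_combination 2 * key + (|a.1 * c.2 - a.2 * c.1| * |b.1 * d.2 - b.2 * d.1| -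
    |a.1 * b.2 - a.2 * b.1| * |c.1 * d.2 - c.2 * d.1| -
    |b.1 * c.2 - b.2 * c.1| * |a.1 * d.2 - a.2 * d.1|) * h2

/-! ### Cyclic order at infinity and crossing geodesics -/

/-- The circle at infinity, cut at the point `c`, is linearly ordered compatibly with a given
orientation `s`. -/
theorem exists_chart {V : Type*} {vec : V → Fin 3 → ℝ} (hcone : ∀ a, vec a ∈ positiveLightCone)
    (hne : ∀ a b, a ≠ b → minkowski (vec a) (vec b) ≠ 0) (c : V) {s : ℝ} (hs : s ≠ 0) :
    ∃ t : V → ℝ, Function.Injective t ∧ (∀ y, y ≠ c → t c < t y) ∧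
      ∀ a b d, t a < t b → t b < t d → 0 < s * orient (vec a) (vec b) (vec d) := by
  classical
  choose q hq using fun a => exists_spin (hcone a)
  set w : V → V → ℝ := fun a b => (q a).1 * (q b).2 - (q a).2 * (q b).1 with hw
  have hw0 : ∀ a b, a ≠ b → w a b ≠ 0 := fun a b hab h0 => by
    apply hne a b hab
    rw [hq a, hq b, minkowski_spin]
    simp only [hw] at h0
    rw [h0]; ring
  have hor : ∀ a b d, orient (vec a) (vec b) (vec d) = -4 * (w a b * w b d * w d a) := by
    intro a b d
    rw [hq a, hq b, hq d, orient_spin]; simp only [hw]; ring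
  set n : ℝ := (q c).1 ^ 2 + (q c).2 ^ 2 with hn
  have hnpos : 0 < n := by
    have := (hcone c).2
    rw [hq c] at this
    simpa [spin] using this
  -- A projective coordinate with its pole at `c`: the cotangent of the angle between the spinors,
  -- scaled by `-s`. Its differences are plane determinants up to known factors.
  set r : V → ℝ := fun a => -s * (((q c).1 * (q a).1 + (q c).2 * (q a).2) / w c a) with hr
  have hdiff : ∀ a b, a ≠ c → b ≠ c → (r b - r a) * (w c a * w c b) = s * n * w a b := by
    intro a b ha hb
    have h1 := hw0 c a ha.symm
    have h2 := hw0 c b hb.symm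
    simp only [hr]
    field_simp
    simp only [hw, hn]
    ring
  have hbase : ∀ a b, a ≠ c → b ≠ c → r a < r b → 0 < s * orient (vec c) (vec a) (vec b) := by
    intro a b ha hb hlt
    rw [hor]
    have h1 := hw0 c a ha.symm
    have h2 := hw0 c b hb.symm
    have h3 := hdiff a b ha hb
    have h4 : s * (-4 * (w c a * w a b * w b c)) * n = 4 * (r b - r a) * (w c a * w c b) ^ 2 := by
      have : w b c = - w c b := by simp only [hw]; ring
      rw [this]
      linear_combination (-4) * (w c a * w c b) * h3
    have h5 : 0 < 4 * (r b - r a) * (w c a * w c b) ^ 2 := by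
      have : 0 < r b - r a := sub_pos.2 hlt
      positivity
    rw [← h4] at h5
    exact pos_of_mul_pos_left h5 hnpos.le
  -- The arctangent squeezes the coordinate into an interval above `-2`, which leaves room for `c`
  -- as the least point.
  refine ⟨fun a => if a = c then -2 else Real.arctan (r a), ?_, ?_, ?_⟩
  · have hinj : ∀ a b, a ≠ c → b ≠ c → r a = r b → a = b := by
      intro a b ha hb h
      by_contra hab
      have h3 := hdiff a b ha hb
      rw [h, sub_self, zero_mul] at h3
      exact (mul_ne_zero (mul_ne_zero hs hnpos.ne') (hw0 a b hab)) h3.symm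
    have h2 : ∀ x : ℝ, (-2 : ℝ) ≠ Real.arctan x := fun x h => by
      have := Real.neg_pi_div_two_lt_arctan x
      have := Real.pi_lt_four
      linarith
    intro a b hab
    by_cases ha : a = c <;> by_cases hb : b = c
    · rw [ha, hb]
    · simp only [ha, hb, if_true, if_false] at hab
      exact absurd hab (h2 _)
    · simp only [ha, hb, if_true, if_false] at hab
      exact absurd hab.symm (h2 _)
    · simp only [ha, hb, if_false] at hab
      exact hinj a b ha hb (Real.arctan_injective hab)
  · intro y hy
    simp only [hy, if_true, if_false]
    have := Real.neg_pi_div_two_lt_arctan (r y)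
    have := Real.pi_lt_four
    linarith
  · have h2 : ∀ x : ℝ, ¬ Real.arctan x < -2 := fun x h => by
      have := Real.neg_pi_div_two_lt_arctan x
      have := Real.pi_lt_four
      linarith
    intro a b d hab hbd
    by_cases hb : b = c
    · simp only [hb, if_true] at hab
      split_ifs at hab
      · exact absurd hab (lt_irrefl _)
      · exact absurd hab (h2 _)
    by_cases hd : d = c
    · simp only [hd, hb, if_true, if_false] at hbd
      exact absurd hbd (h2 _)
    simp only [hd, hb, if_false, Real.arctan_lt_arctan_iff] at hbd
    by_cases ha : a = c
    · rw [ha]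
      exact hbase b d hb hd hbd
    simp only [ha, hb, if_false, Real.arctan_lt_arctan_iff] at hab
    rw [hor]
    have h1 := hdiff a b ha hb
    have h3 := hdiff b d hb hd
    have h4 := hdiff d a hd ha
    have hp := hw0 c a (Ne.symm ha)
    have hq' := hw0 c b (Ne.symm hb)
    have hr' := hw0 c d (Ne.symm hd)
    have h5 : s * (-4 * (w a b * w b d * w d a)) * (s ^ 2 * n ^ 3) =
        4 * ((r b - r a) * (r d - r b) * (r d - r a)) * (w c a * w c b * w c d) ^ 2 := by
      have e1 : s * n * w a b * (s * n * w b d) * (s * n * w d a) =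
        (r b - r a) * (w c a * w c b) * ((r d - r b) * (w c b * w c d)) *
          ((r a - r d) * (w c d * w c a)) := by rw [h1, h3, h4]
      linear_combination (-4) * e1
    have h6 : 0 < 4 * ((r b - r a) * (r d - r b) * (r d - r a)) * (w c a * w c b * w c d) ^ 2 := by
      have := sub_pos.2 hab
      have := sub_pos.2 hbd
      have := sub_pos.2 (hab.trans hbd)
      positivity
    rw [← h5] at h6
    exact pos_of_mul_pos_left h6 (by positivity)

/-- The geodesics `ab` and `xy` joining four points at infinity cross. -/
def Crosses (a b x y : Fin 3 → ℝ) : Prop := orient a b x * orient a b y < 0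

/-- Both `orient` and the Vandermonde product alternate under permutations, so agreement of signs on
increasing triples propagates to all triples. -/
theorem chart_sign {V : Type*} {vec : V → Fin 3 → ℝ} {t : V → ℝ} {s : ℝ}
    (hinj : Function.Injective t)
    (hor : ∀ a b d, t a < t b → t b < t d → 0 < s * orient (vec a) (vec b) (vec d)) (a b d : V) :
    ∃ k : ℝ, 0 < k ∧ s * orient (vec a) (vec b) (vec d) =
      k * ((t b - t a) * (t d - t b) * (t d - t a)) := by
  have h1 := orient_swap_left (vec a) (vec b) (vec d)
  have h2 := orient_swap_right (vec a) (vec b) (vec d)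
  have h3 := orient_swap_left (vec a) (vec d) (vec b)
  have h4 := orient_swap_right (vec b) (vec a) (vec d)
  have h5 := orient_swap_right (vec d) (vec a) (vec b)
  have degen : orient (vec a) (vec b) (vec d) = 0 →
      (t b - t a) * (t d - t b) * (t d - t a) = 0 → ∃ k : ℝ, 0 < k ∧
      s * orient (vec a) (vec b) (vec d) = k * ((t b - t a) * (t d - t b) * (t d - t a)) :=
    fun e1 e2 => ⟨1, one_pos, by rw [e1, e2]; ring⟩
  have pos : 0 < (s * orient (vec a) (vec b) (vec d)) *
      ((t b - t a) * (t d - t b) * (t d - t a)) → ∃ k : ℝ, 0 < k ∧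
      s * orient (vec a) (vec b) (vec d) = k * ((t b - t a) * (t d - t b) * (t d - t a)) := by
    intro h
    have hne : (t b - t a) * (t d - t b) * (t d - t a) ≠ 0 := fun h0 => by
      rw [h0, mul_zero] at h; exact lt_irrefl _ h
    refine ⟨s * orient (vec a) (vec b) (vec d) / ((t b - t a) * (t d - t b) * (t d - t a)), ?_, ?_⟩
    · rw [div_pos_iff]
      rcases pos_and_pos_or_neg_and_neg_of_mul_pos h with h | h
      · exact Or.inl h
      · exact Or.inr h
    · rw [div_mul_cancel₀ _ hne]
  have d1 : orient (vec a) (vec a) (vec d) = 0 := by simp only [orient]; ring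
  have d2 : orient (vec a) (vec b) (vec b) = 0 := by simp only [orient]; ring
  have d3 : orient (vec a) (vec b) (vec a) = 0 := by simp only [orient]; ring
  rcases lt_trichotomy (t a) (t b) with hab | hab | hab
  · rcases lt_trichotomy (t b) (t d) with hbd | hbd | hbd
    · refine pos (mul_pos (hor a b d hab hbd) ?_)
      have := sub_pos.2 hab
      have := sub_pos.2 hbd
      have := sub_pos.2 (hab.trans hbd)
      positivity
    · exact degen (by rw [← hinj hbd, d2]) (by rw [hbd]; ring)
    · rcases lt_trichotomy (t a) (t d) with had | had | had
      · have e := hor a d b had hbd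
        rw [h2] at e
        have := mul_pos (mul_pos (sub_pos.2 hab) (sub_pos.2 hbd)) (sub_pos.2 had)
        exact pos (by nlinarith [mul_pos e this])
      · exact degen (by rw [← hinj had, d3]) (by rw [had]; ring)
      · have e := hor d a b had hab
        rw [h3, h2, neg_neg] at e
        have := mul_pos (mul_pos (sub_pos.2 hab) (sub_pos.2 hbd)) (sub_pos.2 had)
        exact pos (by nlinarith [mul_pos e this])
  · exact degen (by rw [← hinj hab, d1]) (by rw [hab]; ring)
  · rcases lt_trichotomy (t b) (t d) with hbd | hbd | hbd
    · rcases lt_trichotomy (t a) (t d) with had | had | had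
      · have e := hor b a d hab had
        rw [h1] at e
        have := mul_pos (mul_pos (sub_pos.2 hab) (sub_pos.2 hbd)) (sub_pos.2 had)
        exact pos (by nlinarith [mul_pos e this])
      · exact degen (by rw [← hinj had, d3]) (by rw [had]; ring)
      · have e := hor b d a hbd had
        rw [h4, h1, neg_neg] at e
        have := mul_pos (mul_pos (sub_pos.2 hab) (sub_pos.2 hbd)) (sub_pos.2 had)
        exact pos (by nlinarith [mul_pos e this])
    · exact degen (by rw [← hinj hbd, d2]) (by rw [hbd]; ring)
    · have e := hor d b a hbd hab
      rw [h5, h3, h2, neg_neg] at e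
      have := mul_pos (mul_pos (sub_pos.2 hab) (sub_pos.2 hbd)) (sub_pos.2 (hbd.trans hab))
      exact pos (by nlinarith [mul_pos e this])

/-- The sign on the right tells whether exactly one of `x`, `y` lies between `a` and `b`, which
makes crossing a purely order-theoretic notion. -/
theorem crosses_iff_chart {V : Type*} {vec : V → Fin 3 → ℝ} {t : V → ℝ} {s : ℝ} (hs : s ≠ 0)
    (hinj : Function.Injective t)
    (hor : ∀ a b d, t a < t b → t b < t d → 0 < s * orient (vec a) (vec b) (vec d))
    {a b x y : V} (hab : a ≠ b) : Crosses (vec a) (vec b) (vec x) (vec y) ↔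
      ((t x - t a) * (t x - t b)) * ((t y - t a) * (t y - t b)) < 0 := by
  obtain ⟨k, hk, ek⟩ := chart_sign hinj hor a b x
  obtain ⟨l, hl, el⟩ := chart_sign hinj hor a b y
  have hne : t b - t a ≠ 0 := fun h => hab (hinj (sub_eq_zero.1 h)).symm
  have key : s ^ 2 * (orient (vec a) (vec b) (vec x) * orient (vec a) (vec b) (vec y)) =
      (k * l * (t b - t a) ^ 2) * (((t x - t a) * (t x - t b)) * ((t y - t a) * (t y - t b))) := by
    linear_combination (s * orient (vec a) (vec b) (vec y)) * ek +
      (k * ((t b - t a) * (t x - t b) * (t x - t a))) * el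
  have h1 : 0 < s ^ 2 := by positivity
  have h2 : 0 < k * l * (t b - t a) ^ 2 := by positivity
  rw [Crosses]
  constructor
  · intro h
    exact neg_of_mul_neg_right (key ▸ mul_neg_of_pos_of_neg h1 h) h2.le
  · intro h
    exact neg_of_mul_neg_right (key.symm ▸ mul_neg_of_pos_of_neg h2 h) h1.le

/-! ### Shortest paths in non-crossing graphs -/

theorem exists_last_false {P : ℕ → Prop} {i k : ℕ} (hik : i ≤ k) (hi : ¬ P i) (hk : P k) :
    ∃ l, i ≤ l ∧ l < k ∧ ¬ P l ∧ P (l + 1) := by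
  induction k, hik using Nat.le_induction with
  | base => exact absurd hk hi
  | succ k hik ih =>
    by_cases h : P k
    · obtain ⟨l, h1, h2, h3⟩ := ih h
      exact ⟨l, h1, h2.trans k.lt_succ_self, h3⟩
    · exact ⟨k, hik, k.lt_succ_self, h, hk⟩

theorem exists_next_false {P : ℕ → Prop} {k j : ℕ} (hkj : k ≤ j) (hk : P k) (hj : ¬ P j) :
    ∃ l, k ≤ l ∧ l < j ∧ P l ∧ ¬ P (l + 1) := by
  obtain ⟨l, h1, h2, h3, h4⟩ := exists_last_false (P := fun n => ¬ P n) hkj (not_not.2 hk) hj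
  exact ⟨l, h1, h2, not_not.1 h3, h4⟩

/-- A shortest path in a graph that is non-crossing with respect to a linear order is monotone
as long as it stays below `d` and does not meet edges that pass over `d`. -/
theorem monotone_of_noncrossing {V : Type*} (G : SimpleGraph V) {t : V → ℝ}
    (hinj : Function.Injective t) {c d : V} (hc : ∀ y, y ≠ c → t c < t y)
    (hnc : ∀ a b x y, G.Adj a b → G.Adj x y → t a < t x → t x < t b → t b < t y → False)
    {p : ℕ → V} {i j : ℕ} (hij : i + 1 < j)
    (hadj : ∀ k, i ≤ k → k < j → G.Adj (p k) (p (k + 1)))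
    (hsh : ∀ k l, i ≤ k → k ≤ l → l ≤ j → (p k = p l → k = l) ∧ (G.Adj (p k) (p l) → l = k + 1))
    (hend : ∀ y, y = p i ∨ y = p j → t y ≤ t d → y = c ∨ y = d ∨ ∃ w, G.Adj y w ∧ t d < t w)
    (hint : ∀ k, i < k → k < j → p k ≠ d ∧ (t (p k) < t d → ∀ w, G.Adj (p k) w → t w ≤ t d))
    (hstart : t (p (i + 1)) < t d) :
    (∀ k, i ≤ k → k + 1 < j → t (p k) < t (p (k + 1)) ∧ t (p (k + 1)) < t (p (k + 2)) ∧
      ∀ w, G.Adj (p (k + 1)) w → t (p k) ≤ t w ∧ t w ≤ t (p (k + 2))) ∨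
    (∀ k, i ≤ k → k + 1 < j → t (p (k + 1)) < t (p k) ∧ t (p (k + 2)) < t (p (k + 1)) ∧
      ∀ w, G.Adj (p (k + 1)) w → t (p (k + 2)) ≤ t w ∧ t w ≤ t (p k)) := by
  -- An interior vertex below `d` has no neighbour above `d`, and no interior vertex is `d` itself,
  -- so the interior of the path never gets past `d`.
  have hlt : ∀ k, i + 1 ≤ k → k < j → t (p k) < t d := by
    intro k hk
    induction k, hk using Nat.le_induction with
    | base => exact fun _ => hstart
    | succ k hk ih =>
      intro hkj
      have h := (hint k (by omega) (by omega)).2 (ih (by omega)) _ (hadj k (by omega) (by omega))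
      exact lt_of_le_of_ne h fun e => (hint (k + 1) (by omega) hkj).1 (hinj e)
  have hle : ∀ k, i ≤ k → k ≤ j → t (p k) ≤ t d := by
    intro k hik hkj
    rcases hik.eq_or_lt with rfl | hik
    · exact (hint (i + 1) (by omega) hij).2 hstart _ (hadj i le_rfl (by omega)).symm
    rcases hkj.eq_or_lt with rfl | hkj
    · obtain ⟨k, rfl⟩ : ∃ k', k = k' + 1 := ⟨k - 1, by omega⟩
      exact (hint k (by omega) (by omega)).2 (hlt k (by omega) (by omega)) _
        (hadj k (by omega) (by omega))
    · exact (hlt k hik hkj).le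
  -- The key fact: no step of the path runs underneath an edge `xy`, unless its ends are among `x`
  -- and `y`.
  have hcover : ∀ x y, G.Adj x y → t x < t y → t y ≤ t d → ∀ k, i ≤ k → k < j →
      t x ≤ t (p k) → t (p k) ≤ t y → t x ≤ t (p (k + 1)) → t (p (k + 1)) ≤ t y →
      (p k = x ∨ p k = y) ∧ (p (k + 1) = x ∨ p (k + 1) = y) := by
    intro x y hxy hlt hyd k hik hkj h1 h2 h3 h4
    -- The ends of the path are not strictly under `xy`: `c` is minimal, `d` is not below `y`, and
    -- an edge reaching beyond `d` would cross `xy`.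
    have hout : ∀ z, (z = p i ∨ z = p j) → t z ≤ t d → ¬ (t x < t z ∧ t z < t y) := by
      rintro z hz hzd ⟨h5, h6⟩
      rcases hend z hz hzd with rfl | rfl | ⟨w, hw, hdw⟩
      · by_cases hx : x = z
        · rw [hx] at h5; exact lt_irrefl _ h5
        · exact lt_asymm h5 (hc x hx)
      · linarith
      · exact hnc x y z w hxy hw h5 h6 (by linarith)
    by_contra hcon
    obtain ⟨s, his, hsj, hs⟩ : ∃ s, i ≤ s ∧ s ≤ j ∧ (t x < t (p s) ∧ t (p s) < t y) := by
      by_contra hno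
      push Not at hno
      apply hcon
      have aux : ∀ s, i ≤ s → s ≤ j → t x ≤ t (p s) → t (p s) ≤ t y → p s = x ∨ p s = y := by
        intro s h5 h6 h7 h8
        rcases h7.eq_or_lt with h9 | h9
        · exact Or.inl (hinj h9.symm)
        · exact Or.inr (hinj (le_antisymm h8 (hno s h5 h6 h9)))
      exact ⟨aux k hik hkj.le h1 h2, aux (k + 1) (by omega) (by omega) h3 h4⟩
    have hstep : ∀ u v, G.Adj u v → (t x < t u ∧ t u < t y) → ¬ (t x < t v ∧ t v < t y) →
        v = x ∨ v = y := by
      intro u v huv hu hv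
      rcases lt_trichotomy (t v) (t x) with h | h | h
      · exact (hnc v u x y huv.symm hxy h hu.1 hu.2).elim
      · exact Or.inl (hinj h)
      rcases lt_trichotomy (t v) (t y) with h' | h' | h'
      · exact absurd ⟨h, h'⟩ hv
      · exact Or.inr (hinj h')
      · exact (hnc x y u v hxy huv hu.1 hu.2 h').elim
    -- A visit strictly under `xy` must begin and end at `x` or `y`. These two positions on the path
    -- are at least two steps apart, yet their vertices are equal or adjacent, against minimality.
    obtain ⟨a, ha1, ha2, ha3, ha4⟩ := exists_last_false (P := fun s => t x < t (p s) ∧ t (p s) < t y)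
      his (hout _ (Or.inl rfl) (hle i le_rfl (by omega))) hs
    obtain ⟨b, hb1, hb2, hb3, hb4⟩ := exists_next_false (P := fun s => t x < t (p s) ∧ t (p s) < t y)
      hsj hs (hout _ (Or.inr rfl) (hle j (by omega) le_rfl))
    have h5 := hstep _ _ (hadj a ha1 (by omega)).symm ha4 ha3
    have h6 := hstep _ _ (hadj b (by omega) hb2) hb3 hb4
    have h7 := hsh a (b + 1) ha1 (by omega) (by omega)
    have h8 : p a = p (b + 1) ∨ G.Adj (p a) (p (b + 1)) := by
      rcases h5 with h5 | h5 <;> rcases h6 with h6 | h6 <;> rw [h5, h6]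
      · exact Or.inl rfl
      · exact Or.inr hxy
      · exact Or.inr hxy.symm
      · exact Or.inl rfl
    rcases h8 with h8 | h8
    · have := h7.1 h8; omega
    · have := h7.2 h8; omega
  have hne : ∀ k l, i ≤ k → k < l → l ≤ j → p k ≠ p l := fun k l h1 h2 h3 e =>
    h2.ne ((hsh k l h1 h2.le h3).1 e)
  -- At a vertex where the path reverses, the nearer of its two neighbours gives a step lying under
  -- the edge to the farther one.
  have hnotmin : ∀ k, i ≤ k → k + 1 < j → ¬ (t (p (k + 1)) < t (p k) ∧
      t (p (k + 1)) < t (p (k + 2))) := by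
    rintro k hik hkj ⟨h1, h2⟩
    rcases lt_trichotomy (t (p k)) (t (p (k + 2))) with h | h | h
    · rcases (hcover _ _ (hadj (k + 1) (by omega) hkj) h2 (hle _ (by omega) (by omega)) k hik
        (by omega) h1.le h.le le_rfl h2.le).1 with e | e
      · exact hne k (k + 1) hik (by omega) (by omega) e
      · exact hne k (k + 2) hik (by omega) (by omega) e
    · exact hne k (k + 2) hik (by omega) (by omega) (hinj h)
    · rcases (hcover _ _ (hadj k hik (by omega)).symm h1 (hle _ (by omega) (by omega)) (k + 1)
        (by omega) (by omega) le_rfl h1.le h2.le h.le).2 with e | e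
      · exact hne (k + 1) (k + 2) (by omega) (by omega) (by omega) e.symm
      · exact hne k (k + 2) hik (by omega) (by omega) e.symm
  have hnotmax : ∀ k, i ≤ k → k + 1 < j → ¬ (t (p k) < t (p (k + 1)) ∧
      t (p (k + 2)) < t (p (k + 1))) := by
    rintro k hik hkj ⟨h1, h2⟩
    rcases lt_trichotomy (t (p k)) (t (p (k + 2))) with h | h | h
    · rcases (hcover _ _ (hadj k hik (by omega)) h1 (hle _ (by omega) (by omega)) (k + 1)
        (by omega) (by omega) h1.le le_rfl h.le h2.le).2 with e | e
      · exact hne k (k + 2) hik (by omega) (by omega) e.symm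
      · exact hne (k + 1) (k + 2) (by omega) (by omega) (by omega) e.symm
    · exact hne k (k + 2) hik (by omega) (by omega) (hinj h)
    · rcases (hcover _ _ (hadj (k + 1) (by omega) hkj).symm h2 (hle _ (by omega) (by omega)) k hik
        (by omega) h.le h1.le h2.le le_rfl).1 with e | e
      · exact hne k (k + 2) hik (by omega) (by omega) e
      · exact hne k (k + 1) hik (by omega) (by omega) e
  have hnet : ∀ k, i ≤ k → k < j → t (p k) ≠ t (p (k + 1)) := fun k h1 h2 e =>
    hne k (k + 1) h1 (by omega) (by omega) (hinj e)
  rcases lt_or_gt_of_ne (hnet i le_rfl (by omega)) with h0 | h0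
  · have hmono : ∀ k, i ≤ k → k < j → t (p k) < t (p (k + 1)) := by
      intro k hk
      induction k, hk using Nat.le_induction with
      | base => exact fun _ => h0
      | succ k hk ih =>
        intro hkj
        rcases lt_or_gt_of_ne (hnet (k + 1) (by omega) hkj) with h | h
        · exact h
        · exact absurd ⟨ih (by omega), h⟩ (hnotmax k hk hkj)
    -- A neighbour outside the interval spanned by the two path neighbours would give an edge
    -- covering a step of the path.
    refine Or.inl fun k hik hkj => ⟨hmono k hik (by omega), hmono (k + 1) (by omega) hkj, ?_⟩
    intro w hw
    have hk := hmono k hik (by omega)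
    have hk' := hmono (k + 1) (by omega) hkj
    have hwd := (hint (k + 1) (by omega) hkj).2 (hlt (k + 1) (by omega) hkj) w hw
    constructor
    · by_contra hcon
      rw [not_le] at hcon
      rcases (hcover _ _ hw.symm (hcon.trans hk) (hle _ (by omega) (by omega)) k hik (by omega)
        hcon.le hk.le (hcon.trans hk).le le_rfl).1 with e | e
      · exact hcon.ne (by rw [e])
      · exact hk.ne (by rw [e])
    · by_contra hcon
      rw [not_le] at hcon
      rcases (hcover _ _ hw (hk'.trans hcon) hwd (k + 1) (by omega) (by omega) le_rfl
        (hk'.trans hcon).le hk'.le hcon.le).2 with e | e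
      · exact hk'.ne (by rw [e])
      · exact hcon.ne (by rw [e])
  · have hmono : ∀ k, i ≤ k → k < j → t (p (k + 1)) < t (p k) := by
      intro k hk
      induction k, hk using Nat.le_induction with
      | base => exact fun _ => h0
      | succ k hk ih =>
        intro hkj
        rcases lt_or_gt_of_ne (hnet (k + 1) (by omega) hkj) with h | h
        · exact absurd ⟨ih (by omega), h⟩ (hnotmin k hk hkj)
        · exact h
    refine Or.inr fun k hik hkj => ⟨hmono k hik (by omega), hmono (k + 1) (by omega) hkj, ?_⟩
    intro w hw
    have hk := hmono k hik (by omega)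
    have hk' := hmono (k + 1) (by omega) hkj
    have hwd := (hint (k + 1) (by omega) hkj).2 (hlt (k + 1) (by omega) hkj) w hw
    constructor
    · by_contra hcon
      rw [not_le] at hcon
      rcases (hcover _ _ hw.symm (hcon.trans hk') (hle _ (by omega) (by omega)) (k + 1) (by omega)
        (by omega) (hcon.trans hk').le le_rfl hcon.le hk'.le).2 with e | e
      · exact hcon.ne (by rw [e])
      · exact hk'.ne (by rw [e])
    · by_contra hcon
      rw [not_le] at hcon
      rcases (hcover _ _ hw (hk.trans hcon) hwd k hik (by omega) hk.le hcon.le le_rfl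
        (hk.trans hcon).le).1 with e | e
      · exact hk.ne (by rw [e])
      · exact hcon.ne (by rw [e])

/-- Let a shortest path in a non-crossing graph have no interior vertex with an edge that crosses the
geodesic `cd`, while its endpoints have one. Then the path always turns in the same direction, and the
edges at each interior vertex do not cross the geodesic joining its two neighbours on the path. -/
theorem turns_of_noncrossing {V : Type*} (G : SimpleGraph V) {vec : V → Fin 3 → ℝ}
    (hcone : ∀ a, vec a ∈ positiveLightCone)
    (hne : ∀ a b, a ≠ b → minkowski (vec a) (vec b) ≠ 0)
    (hnc : ∀ a b x y, G.Adj a b → G.Adj x y → ¬ Crosses (vec a) (vec b) (vec x) (vec y))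
    {c d : V} (hcd : c ≠ d) {p : ℕ → V} {i j : ℕ}
    (hadj : ∀ k, i ≤ k → k < j → G.Adj (p k) (p (k + 1)))
    (hsh : ∀ k l, i ≤ k → k ≤ l → l ≤ j → (p k = p l → k = l) ∧ (G.Adj (p k) (p l) → l = k + 1))
    (hend : ∀ y, y = p i ∨ y = p j →
      y = c ∨ y = d ∨ ∃ w, G.Adj y w ∧ Crosses (vec c) (vec d) (vec y) (vec w))
    (hint : ∀ k, i < k → k < j → p k ≠ c ∧ p k ≠ d ∧
      ∀ w, G.Adj (p k) w → ¬ Crosses (vec c) (vec d) (vec (p k)) (vec w)) :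
    ∃ e : ℝ, ∀ k, i ≤ k → k + 1 < j →
      0 < e * orient (vec (p k)) (vec (p (k + 1))) (vec (p (k + 2))) ∧
      ∀ w, G.Adj (p (k + 1)) w →
        ¬ Crosses (vec (p (k + 1))) (vec w) (vec (p k)) (vec (p (k + 2))) := by
  by_cases hij : i + 1 < j
  swap
  · exact ⟨0, fun k h1 h2 => absurd h2 (by omega)⟩
  obtain ⟨hpc, hpd, -⟩ := hint (i + 1) (by omega) hij
  -- The orientation is chosen so that the first interior vertex lies on the arc from `c` to `d`.
  obtain ⟨s, hs, t, hinj, hc, hor, hstart⟩ : ∃ s : ℝ, s ≠ 0 ∧ ∃ t : V → ℝ, Function.Injective t ∧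
      (∀ y, y ≠ c → t c < t y) ∧
      (∀ a b d, t a < t b → t b < t d → 0 < s * orient (vec a) (vec b) (vec d)) ∧
      t (p (i + 1)) < t d := by
    obtain ⟨t, h1, h2, h3⟩ := exists_chart hcone hne c (one_ne_zero (α := ℝ))
    rcases lt_trichotomy (t (p (i + 1))) (t d) with h | h | h
    · exact ⟨1, one_ne_zero, t, h1, h2, h3, h⟩
    · exact absurd (h1 h) hpd
    · obtain ⟨t', h1', h2', h3'⟩ := exists_chart hcone hne c (neg_ne_zero.2 (one_ne_zero (α := ℝ)))
      refine ⟨-1, by norm_num, t', h1', h2', h3', ?_⟩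
      rcases lt_trichotomy (t' (p (i + 1))) (t' d) with h' | h' | h'
      · exact h'
      · exact absurd (h1' h') hpd
      · have e1 := h3 c d (p (i + 1)) (h2 d hcd.symm) h
        have e2 := h3' c d (p (i + 1)) (h2' d hcd.symm) h'
        linarith
  have hcross := fun {a b x y : V} (hab : a ≠ b) =>
    crosses_iff_chart (x := x) (y := y) hs hinj hor hab
  have hmain := monotone_of_noncrossing G hinj (c := c) (d := d) hc ?_ hij hadj hsh ?_ ?_ hstart
  · rcases hmain with h | h
    · refine ⟨s, fun k hik hkj => ?_⟩
      obtain ⟨h1, h2, h3⟩ := h k hik hkj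
      refine ⟨hor _ _ _ h1 h2, fun w hw => ?_⟩
      obtain ⟨h4, h5⟩ := h3 w hw
      rw [hcross hw.ne, not_lt]
      exact mul_nonneg (mul_nonneg_of_nonpos_of_nonpos (by linarith) (by linarith))
        (mul_nonneg (by linarith) (by linarith))
    · refine ⟨-s, fun k hik hkj => ?_⟩
      obtain ⟨h1, h2, h3⟩ := h k hik hkj
      refine ⟨?_, fun w hw => ?_⟩
      · have e := hor _ _ _ h2 h1
        rw [orient_swap_left, orient_swap_right, orient_swap_left] at e
        linarith
      · obtain ⟨h4, h5⟩ := h3 w hw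
        rw [hcross hw.ne, not_lt]
        exact mul_nonneg (mul_nonneg (by linarith) (by linarith))
          (mul_nonneg_of_nonpos_of_nonpos (by linarith) (by linarith))
  · intro a b x y hab hxy h1 h2 h3
    apply hnc a b x y hab hxy
    rw [hcross hab.ne]
    exact mul_neg_of_neg_of_pos (mul_neg_of_pos_of_neg (by linarith) (by linarith))
      (mul_pos (by linarith) (by linarith))
  · intro y hy hyd
    rcases hend y hy with h | h | ⟨w, hw, hw'⟩
    · exact Or.inl h
    · exact Or.inr (Or.inl h)
    · refine Or.inr (Or.inr ⟨w, hw, ?_⟩)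
      rw [hcross hcd] at hw'
      by_contra hcon
      rw [not_lt] at hcon
      have hmin : ∀ z, t c ≤ t z := fun z => by
        by_cases hz : z = c
        · rw [hz]
        · exact (hc z hz).le
      have h1 := hmin y
      have h2 := hmin w
      exact absurd hw' (not_lt.2 (mul_nonneg_of_nonpos_of_nonpos
        (mul_nonpos_of_nonneg_of_nonpos (by linarith) (by linarith))
        (mul_nonpos_of_nonneg_of_nonpos (by linarith) (by linarith))))
  · intro k h1 h2
    obtain ⟨h3, h4, h5⟩ := hint k h1 h2
    refine ⟨h4, fun h6 w hw => ?_⟩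
    by_contra hcon
    rw [not_le] at hcon
    apply h5 w hw
    rw [hcross hcd]
    have h7 := hc _ h3
    have h8 := hc d hcd.symm
    exact mul_neg_of_neg_of_pos (mul_neg_of_pos_of_neg (by linarith) (by linarith))
      (mul_pos (by linarith) (by linarith))

/-! ### Periodicity of turning paths and quasigeodesics -/

theorem Crosses.mul_left {π : Type*} [Group π] {vec : π → Fin 3 → ℝ} {D : π → ℝ}
    (hD : ∀ g a b c, orient (vec (g * a)) (vec (g * b)) (vec (g * c)) =
      D g * orient (vec a) (vec b) (vec c)) {g a b x y : π}
    (h : Crosses (vec (g * a)) (vec (g * b)) (vec (g * x)) (vec (g * y))) :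
    Crosses (vec a) (vec b) (vec x) (vec y) := by
  rw [Crosses, hD, hD] at h
  rw [Crosses]
  exact neg_of_mul_neg_right (by linarith : D g ^ 2 *
    (orient (vec a) (vec b) (vec x) * orient (vec a) (vec b) (vec y)) < 0) (sq_nonneg _)

/-- Consecutive edges at a vertex, in a given direction of rotation, determine each other. -/
theorem eq_of_turns {V : Type*} (G : SimpleGraph V) {vec : V → Fin 3 → ℝ}
    (hcone : ∀ a, vec a ∈ positiveLightCone)
    (hne : ∀ a b, a ≠ b → minkowski (vec a) (vec b) ≠ 0) {x y z z' : V} {e : ℝ}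
    (hx : x ≠ y) (hz : G.Adj y z) (hz' : G.Adj y z')
    (he : 0 < e * orient (vec x) (vec y) (vec z)) (he' : 0 < e * orient (vec x) (vec y) (vec z'))
    (hc : ∀ w, G.Adj y w → ¬ Crosses (vec y) (vec w) (vec x) (vec z))
    (hc' : ∀ w, G.Adj y w → ¬ Crosses (vec y) (vec w) (vec x) (vec z')) : z = z' := by
  -- With the circle cut at `y`, the points `z` and `z'` lie on the same side of `x`. If they
  -- differed, the one nearer to `x` would give an edge at `y` separating `x` from the other.
  obtain ⟨t, hinj, hy, hor⟩ := exists_chart hcone hne y (one_ne_zero (α := ℝ))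
  have hcross := fun {a b x y : V} (hab : a ≠ b) =>
    crosses_iff_chart (x := x) (y := y) one_ne_zero hinj hor hab
  obtain ⟨k, hk, ek⟩ := chart_sign hinj hor x y z
  obtain ⟨l, hl, el⟩ := chart_sign hinj hor x y z'
  have hxy := hy x hx
  have hzy := hy z hz.ne'
  have hzy' := hy z' hz'.ne'
  have h1 := hc z' hz'
  have h2 := hc' z hz
  rw [hcross hz'.ne] at h1
  rw [hcross hz.ne] at h2
  have hsame : 0 < (t z - t x) * (t z' - t x) := by
    have h3 := mul_pos he he'
    rw [one_mul] at ek el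
    rw [ek, el] at h3
    have h4 : 0 < e ^ 2 * k * l * (t y - t x) ^ 2 * (t z - t y) * (t z' - t y) *
      ((t z - t x) * (t z' - t x)) := by linarith
    refine pos_of_mul_pos_right h4 ?_
    have := sub_pos.2 hzy
    have := sub_pos.2 hzy'
    positivity
  by_contra hzz
  have hzz' : t z ≠ t z' := fun h => hzz (hinj h)
  rcases pos_and_pos_or_neg_and_neg_of_mul_pos hsame with ⟨h3, h4⟩ | ⟨h3, h4⟩ <;>
    rcases lt_or_gt_of_ne hzz' with h5 | h5
  · exact h2 (mul_neg_of_neg_of_pos (mul_neg_of_pos_of_neg (by linarith) (by linarith))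
      (mul_pos (by linarith) (by linarith)))
  · exact h1 (mul_neg_of_neg_of_pos (mul_neg_of_pos_of_neg (by linarith) (by linarith))
      (mul_pos (by linarith) (by linarith)))
  · exact h1 (mul_neg_of_pos_of_neg (mul_pos (by linarith) (by linarith))
      (mul_neg_of_pos_of_neg (by linarith) (by linarith)))
  · exact h2 (mul_neg_of_pos_of_neg (mul_pos (by linarith) (by linarith))
      (mul_neg_of_pos_of_neg (by linarith) (by linarith)))

/-- A path in a locally finite invariant graph that at each vertex turns from one edge to a
consecutive one, always in the same direction, is periodic up to a bounded initial part. -/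
theorem periodic_of_turns {π : Type*} [Group π] (G : SimpleGraph π) {vec : π → Fin 3 → ℝ}
    (hcone : ∀ a, vec a ∈ positiveLightCone)
    (hne : ∀ a b, a ≠ b → minkowski (vec a) (vec b) ≠ 0) {D : π → ℝ}
    (hD : ∀ g a b c, orient (vec (g * a)) (vec (g * b)) (vec (g * c)) =
      D g * orient (vec a) (vec b) (vec c))
    (hG : ∀ g a b, G.Adj a b → G.Adj (g * a) (g * b)) (F : Finset π)
    (hF : ∀ a b, G.Adj a b → a⁻¹ * b ∈ F) : ∃ N : ℕ, ∀ (q : ℕ → π) (K : ℕ) (e : ℝ),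
      (∀ k < K, G.Adj (q k) (q (k + 1))) →
      (∀ k, k + 1 < K → 0 < e * orient (vec (q k)) (vec (q (k + 1))) (vec (q (k + 2))) ∧
        ∀ w, G.Adj (q (k + 1)) w →
          ¬ Crosses (vec (q (k + 1))) (vec w) (vec (q k)) (vec (q (k + 2)))) →
      K ≤ N ∨ ∃ s P : ℕ, 0 < P ∧ s + P ≤ N ∧ s + P ≤ K ∧
        ∀ u, s + P + u ≤ K → q (s + P + u) = q (s + P) * (q s)⁻¹ * q (s + u) := by
  classical
  refine ⟨(F ×ˢ F).card + 2, fun q K e hadj hturn => ?_⟩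
  by_cases hK : K ≤ (F ×ˢ F).card + 2
  · exact Or.inl hK
  right
  set n := (F ×ˢ F).card with hn
  have hmaps : ∀ k ∈ Finset.range (n + 1),
      ((q (k + 1))⁻¹ * q k, (q (k + 1))⁻¹ * q (k + 2)) ∈ F ×ˢ F := by
    intro k hk
    rw [Finset.mem_range] at hk
    exact Finset.mem_product.2 ⟨hF _ _ (hadj k (by omega)).symm, hF _ _ (hadj (k + 1) (by omega))⟩
  -- A turn, seen from its middle vertex, is an element of `F ×ˢ F`; among one more turns than this
  -- set has elements, two agree up to translation.
  have hpig : ∃ k l, k < l ∧ l ≤ n ∧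
      ((q (k + 1))⁻¹ * q k, (q (k + 1))⁻¹ * q (k + 2)) =
        ((q (l + 1))⁻¹ * q l, (q (l + 1))⁻¹ * q (l + 2)) := by
    obtain ⟨k, hk, l, hl, hkl, h⟩ := Finset.exists_ne_map_eq_of_card_lt_of_maps_to
      (by rw [Finset.card_range]; omega) hmaps
    rw [Finset.mem_range] at hk hl
    rcases lt_or_gt_of_ne hkl with h' | h'
    · exact ⟨k, l, h', by omega, h⟩
    · exact ⟨l, k, h', by omega, h.symm⟩
  obtain ⟨k, l, hkl, hln, hst⟩ := hpig
  rw [Prod.mk.injEq] at hst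
  obtain ⟨hst1, hst2⟩ := hst
  set g := q (l + 1) * (q (k + 1))⁻¹ with hg
  have e0 : q l = g * q k := by
    rw [hg, mul_assoc, hst1, mul_inv_cancel_left]
  have e1 : q (l + 1) = g * q (k + 1) := by rw [hg, inv_mul_cancel_right]
  have e2 : q (l + 2) = g * q (k + 2) := by
    rw [hg, mul_assoc, hst2, mul_inv_cancel_left]
  -- The two matching turns go in the same direction, so the translation `g` preserves orientation.
  -- This allows turns to be compared after translating.
  have hDg : 0 < D g := by
    have h1 := (hturn k (by omega)).1
    have h2 := (hturn l (by omega)).1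
    rw [e0, e1, e2, hD] at h2
    exact pos_of_mul_pos_left (by linarith : 0 < D g *
      (e * orient (vec (q k)) (vec (q (k + 1))) (vec (q (k + 2))))) h1.le
  have hind : ∀ u, l + u + 2 ≤ K → q (l + u) = g * q (k + u) ∧
      q (l + u + 1) = g * q (k + u + 1) ∧ q (l + u + 2) = g * q (k + u + 2) := by
    intro u
    induction u with
    | zero => exact fun _ => ⟨e0, e1, e2⟩
    | succ u ih =>
      intro hu
      obtain ⟨-, i1, i2⟩ := ih (by omega)
      refine ⟨i1, i2, ?_⟩
      obtain ⟨t1, t2⟩ := hturn (l + u + 1) (by omega)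
      obtain ⟨t3, t4⟩ := hturn (k + u + 1) (by omega)
      have a1 := hadj (l + u + 2) (by omega)
      have a2 := hG g _ _ (hadj (k + u + 2) (by omega))
      have a3 := (hadj (l + u + 1) (by omega)).ne
      rw [show l + (u + 1) + 2 = l + u + 3 by ring, show k + (u + 1) + 2 = k + u + 3 by ring]
      -- Both the actual next vertex and the translate of the earlier one are reached by the
      -- consecutive edge in the same direction of rotation.
      refine eq_of_turns G hcone hne a3 a1 (i2 ▸ a2) t1 ?_ t2 ?_
      · rw [show l + u + 1 + 1 = l + u + 2 by ring, i1, i2, hD]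
        rw [show k + u + 1 + 1 = k + u + 2 by ring, show k + u + 1 + 2 = k + u + 3 by ring] at t3
        nlinarith [mul_pos hDg t3]
      · intro w hw hcr
        have hw' := hG g⁻¹ _ _ hw
        rw [show l + u + 1 + 1 = l + u + 2 by ring, i2, inv_mul_cancel_left] at hw'
        apply t4 (g⁻¹ * w) hw'
        apply Crosses.mul_left hD (g := g)
        rw [mul_inv_cancel_left]
        rw [show l + u + 1 + 1 = l + u + 2 by ring, i1, i2] at hcr
        exact hcr
  refine ⟨k, l - k, by omega, by omega, by omega, fun u hu => ?_⟩
  rw [show k + (l - k) = l by omega] at hu ⊢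
  have hgg : q l * (q k)⁻¹ = g := by rw [e0, mul_inv_cancel_right]
  rw [hgg]
  -- The induction handles three successive vertices at once; the last two indices are read off from
  -- the final triple.
  by_cases hu2 : l + u + 2 ≤ K
  · exact (hind u hu2).1
  obtain ⟨v, rfl | rfl⟩ : ∃ v, u = v + 1 ∨ u = v + 2 := by
    rcases u with _ | _ | u
    · omega
    · exact ⟨0, Or.inl rfl⟩
    · exact ⟨u, Or.inr rfl⟩
  · by_cases h : l + v + 2 ≤ K
    · exact (hind v h).2.1
    · obtain ⟨w, rfl⟩ : ∃ w, v = w + 1 := ⟨v - 1, by omega⟩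
      exact (hind w (by omega)).2.2
  · exact (hind v (by omega)).2.2

theorem exists_finite_steps {π : Type*} [Group π] (F : Finset π) (N : ℕ) :
    ∃ W : Set π, W.Finite ∧ ∀ (q : ℕ → π) (a l : ℕ), l ≤ N →
      (∀ k, a ≤ k → k < a + l → (q k)⁻¹ * q (k + 1) ∈ F) → (q a)⁻¹ * q (a + l) ∈ W := by
  induction N with
  | zero =>
    refine ⟨{1}, Set.finite_singleton 1, fun q a l hl _ => ?_⟩
    obtain rfl : l = 0 := by omega
    simp
  | succ N ih =>
    obtain ⟨W, hW, h⟩ := ih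
    refine ⟨W ∪ Set.image2 (· * ·) W F, hW.union (hW.image2 _ F.finite_toSet), fun q a l hl hq => ?_⟩
    rcases Nat.lt_or_ge N l with hlN | hlN
    · obtain rfl : l = N + 1 := by omega
      refine Or.inr ⟨_, h q a N le_rfl fun k h1 h2 => hq k h1 (by omega), _,
        hq (a + N) (by omega) (by omega), ?_⟩
      simp only [mul_assoc, mul_inv_cancel_left]
      rfl
    · exact Or.inl (h q a l hlN hq)

/-- Paths that become periodic after a bounded time are uniformly close to geodesics, if `A` is
(the exponential of) a length function for which cyclic groups are undistorted. -/
theorem exists_quasigeodesic_bound {π : Type*} [Group π] {A : π → ℝ} (hA1 : ∀ g, 1 ≤ A g)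
    (hAinv : ∀ g, A g⁻¹ = A g) {C₀ : ℝ} (hC₀ : 1 ≤ C₀) (hAmul : ∀ g h, A (g * h) ≤ C₀ * (A g * A h))
    (hAhyp : ∀ g, g ≠ 1 → ∃ C, ∀ m n : ℕ, A (g ^ m) * A (g ^ n) ≤ C * A (g ^ (m + n)))
    (F : Finset π) (N : ℕ) : ∃ C : ℝ, ∀ (q : ℕ → π) (K : ℕ),
      (∀ k < K, (q k)⁻¹ * q (k + 1) ∈ F) → (∀ k l, k < l → l ≤ K → q k ≠ q l) →
      (K ≤ N ∨ ∃ s P : ℕ, 0 < P ∧ s + P ≤ N ∧ s + P ≤ K ∧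
        ∀ u, s + P + u ≤ K → q (s + P + u) = q (s + P) * (q s)⁻¹ * q (s + u)) →
      ∀ u ≤ K, A ((q 0)⁻¹ * q u) * A ((q u)⁻¹ * q K) ≤ C * A ((q 0)⁻¹ * q K) := by
  obtain ⟨W, hW, hWq⟩ := exists_finite_steps F N
  obtain ⟨B₀, hB₀⟩ := (hW.image A).bddAbove
  choose! Ch hCh using hAhyp
  -- The undistortion constant depends on the cyclic group, but only finitely many periods occur.
  obtain ⟨H₀, hH₀⟩ := (hW.image Ch).bddAbove
  set B := max B₀ 1 with hB
  set H := max H₀ 1 with hH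
  have hB1 : 1 ≤ B := le_max_right _ _
  have hH1 : 1 ≤ H := le_max_right _ _
  have hWB : ∀ g ∈ W, A g ≤ B := fun g hg =>
    (hB₀ (Set.mem_image_of_mem A hg)).trans (le_max_left _ _)
  have hA0 : ∀ g, 0 ≤ A g := fun g => zero_le_one.trans (hA1 g)
  have hWH : ∀ g ∈ W, g ≠ 1 → ∀ m n : ℕ, A (g ^ m) * A (g ^ n) ≤ H * A (g ^ (m + n)) :=
    fun g hg hg1 m n => (hCh g hg1 m n).trans (mul_le_mul_of_nonneg_right
      ((hH₀ (Set.mem_image_of_mem Ch hg)).trans (le_max_left _ _)) (hA0 _))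
  have hmul3 : ∀ x y z, A (x * y * z) ≤ C₀ ^ 2 * (A x * A y * A z) := fun x y z => by
    calc A (x * y * z) ≤ C₀ * (A (x * y) * A z) := hAmul _ _
      _ ≤ C₀ * ((C₀ * (A x * A y)) * A z) := by
        gcongr
        · exact hA0 z
        · exact hAmul _ _
      _ = _ := by ring
  set E := C₀ ^ 2 * (B * B) with hE
  have hE1 : 1 ≤ E := one_le_mul_of_one_le_of_one_le (one_le_pow₀ hC₀)
    (one_le_mul_of_one_le_of_one_le hB1 hB1)
  have hEsand : ∀ x y z, A x ≤ B → A z ≤ B → A (x * y * z) ≤ E * A y := fun x y z hx hz => by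
    calc A (x * y * z) ≤ C₀ ^ 2 * (A x * A y * A z) := hmul3 _ _ _
      _ ≤ C₀ ^ 2 * (B * A y * B) := by
        have := hA0 x
        have := hA0 y
        have := hA0 z
        gcongr
      _ = _ := by rw [hE]; ring
  have hBE' : C₀ * B * B ≤ E := by
    rw [hE, mul_assoc]
    exact mul_le_mul_of_nonneg_right (le_self_pow₀ hC₀ two_ne_zero) (by positivity)
  refine ⟨E ^ 3 * H, fun q K hqF hinj hper u hu => ?_⟩
  have hW' : ∀ a l, a + l ≤ K → l ≤ N → (q a)⁻¹ * q (a + l) ∈ W := fun a l h1 h2 =>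
    hWq q a l h2 fun k _ hk => hqF k (by omega)
  have hWA : ∀ a b, a ≤ b → b ≤ K → b ≤ a + N → A ((q a)⁻¹ * q b) ≤ B := fun a b h1 h2 h3 => by
    obtain ⟨l, rfl⟩ := Nat.exists_eq_add_of_le h1
    exact hWB _ (hW' a l h2 (by omega))
  have hE3 : E ≤ E ^ 3 * H := by
    calc E = E * 1 := by ring
      _ ≤ E ^ 3 * H := mul_le_mul (le_self_pow₀ hE1 (by norm_num)) hH1 zero_le_one (by positivity)
  have hshort : u ≤ N → A ((q 0)⁻¹ * q u) * A ((q u)⁻¹ * q K) ≤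
      E ^ 3 * H * A ((q 0)⁻¹ * q K) := fun huN => by
    have h1 := hWA 0 u (by omega) hu (by omega)
    have h2 : A ((q u)⁻¹ * q K) ≤ C₀ * (B * A ((q 0)⁻¹ * q K)) := by
      calc A ((q u)⁻¹ * q K) = A ((q u)⁻¹ * q 0 * ((q 0)⁻¹ * q K)) := by
            rw [mul_assoc, mul_inv_cancel_left]
        _ ≤ C₀ * (A ((q u)⁻¹ * q 0) * A ((q 0)⁻¹ * q K)) := hAmul _ _
        _ ≤ _ := by
          have : A ((q u)⁻¹ * q 0) ≤ B := by
            rw [← hAinv, _root_.mul_inv_rev, inv_inv]; exact h1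
          have := hA0 ((q 0)⁻¹ * q K)
          gcongr
    calc A ((q 0)⁻¹ * q u) * A ((q u)⁻¹ * q K) ≤ B * (C₀ * (B * A ((q 0)⁻¹ * q K))) :=
          mul_le_mul h1 h2 (hA0 _) (by positivity)
      _ = C₀ * B * B * A ((q 0)⁻¹ * q K) := by ring
      _ ≤ E ^ 3 * H * A ((q 0)⁻¹ * q K) :=
          mul_le_mul_of_nonneg_right (hBE'.trans hE3) (hA0 _)
  rcases hper with hKN | ⟨s, P, hP, hsPN, hsPK, hper⟩
  · exact hshort (hu.trans hKN)
  by_cases hus : u < s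
  · exact hshort (by omega)
  obtain ⟨v, rfl⟩ := Nat.exists_eq_add_of_le (not_lt.1 hus)
  obtain ⟨V, rfl⟩ := Nat.exists_eq_add_of_le (show s ≤ K by omega)
  set h := q s with hh
  set g := h⁻¹ * q (s + P) with hg
  have hgW : g ∈ W := hW' s P hsPK (by omega)
  -- A trivial period would make the path revisit a vertex.
  have hg1 : g ≠ 1 := fun h1 => hinj s (s + P) (by omega) hsPK (inv_mul_eq_one.1 h1)
  -- Beyond `s` the path follows the powers of `g`. With `r < P` the outer factors have bounded
  -- size, which reduces the claim to the cyclic group of `g`.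
  have hform : ∀ r m, s + (P * m + r) ≤ s + V → q (s + (P * m + r)) = h * g ^ m * (h⁻¹ * q (s + r)) := by
    intro r m
    induction m with
    | zero => intro _; simp
    | succ m ih =>
      intro hm
      have e := hper (P * m + r) (by rw [Nat.mul_succ] at hm; omega)
      rw [show s + (P * (m + 1) + r) = s + P + (P * m + r) by ring, e,
        ih (by rw [Nat.mul_succ] at hm; omega), pow_succ',
        show q (s + P) = h * g by rw [hg, mul_inv_cancel_left]]
      simp only [mul_assoc, inv_mul_cancel_left]
  have hrB : ∀ r, r < P → s + r ≤ s + V → A (h⁻¹ * q (s + r)) ≤ B := fun r h1 h2 =>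
    hWA s (s + r) (by omega) h2 (by omega)
  have hv := hform (v % P) (v / P) (by rw [Nat.div_add_mod]; exact hu)
  have hV := hform (V % P) (V / P) (by rw [Nat.div_add_mod])
  rw [Nat.div_add_mod] at hv hV
  have hvV : v / P ≤ V / P := Nat.div_le_div_right (by omega)
  obtain ⟨n, hn⟩ := Nat.exists_eq_add_of_le hvV
  have hb := hrB (v % P) (Nat.mod_lt _ hP) (by have := Nat.mod_le v P; omega)
  have hb' := hrB (V % P) (Nat.mod_lt _ hP) (by have := Nat.mod_le V P; omega)
  set m := v / P with hm
  set b := h⁻¹ * q (s + v % P) with hbdef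
  set b' := h⁻¹ * q (s + V % P) with hbdef'
  have h0 : A ((q 0)⁻¹ * h) ≤ B := hWA 0 s (by omega) (by omega) (by omega)
  have k1 : A ((q 0)⁻¹ * q (s + v)) ≤ E * A (g ^ m) := by
    rw [hv, show (q 0)⁻¹ * (h * g ^ m * b) = ((q 0)⁻¹ * h) * g ^ m * b by group]
    exact hEsand _ _ _ h0 hb
  have k2 : A ((q (s + v))⁻¹ * q (s + V)) ≤ E * A (g ^ n) := by
    rw [hv, hV, hn, pow_add,
      show (h * g ^ m * b)⁻¹ * (h * (g ^ m * g ^ n) * b') = b⁻¹ * g ^ n * b' by group]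
    exact hEsand _ _ _ (by rw [hAinv]; exact hb) hb'
  have k3 : A (g ^ (m + n)) ≤ E * A ((q 0)⁻¹ * q (s + V)) := by
    rw [← hn, show g ^ (V / P) = (h⁻¹ * q 0) * ((q 0)⁻¹ * q (s + V)) * b'⁻¹ by rw [hV]; group]
    refine hEsand _ _ _ ?_ (by rw [hAinv]; exact hb')
    rw [← hAinv, _root_.mul_inv_rev, inv_inv]; exact h0
  calc A ((q 0)⁻¹ * q (s + v)) * A ((q (s + v))⁻¹ * q (s + V))
      ≤ (E * A (g ^ m)) * (E * A (g ^ n)) :=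
        mul_le_mul k1 k2 (hA0 _) (mul_nonneg (by positivity) (hA0 _))
    _ = E ^ 2 * (A (g ^ m) * A (g ^ n)) := by ring
    _ ≤ E ^ 2 * (H * A (g ^ (m + n))) := 
        mul_le_mul_of_nonneg_left (hWH g hgW hg1 m n) (by positivity)
    _ ≤ E ^ 2 * (H * (E * A ((q 0)⁻¹ * q (s + V)))) := by gcongr
    _ = _ := by ring

/-! ### Growth of the holonomy and of products of spikes -/

theorem abs_minkowski_le (v w : Fin 3 → ℝ) : |minkowski v w| ≤ 3 * (‖v‖ * ‖w‖) := by
  have h : ∀ i, |v i * w i| ≤ ‖v‖ * ‖w‖ := fun i => by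
    rw [abs_mul]
    exact mul_le_mul (norm_le_pi_norm v i) (norm_le_pi_norm w i) (abs_nonneg _) (norm_nonneg _)
  have h0 := abs_le.1 (h 0)
  have h1 := abs_le.1 (h 1)
  have h2 := abs_le.1 (h 2)
  rw [minkowski, abs_le]
  constructor <;> linarith [h0.1, h0.2, h1.1, h1.2, h2.1, h2.2]

/-- Being proportional is transitive for light-like vectors. -/
theorem minkowski_eq_zero_trans {a b c : Fin 3 → ℝ} (ha : a ∈ positiveLightCone)
    (hb : b ∈ positiveLightCone) (hc : c ∈ positiveLightCone) (h1 : minkowski a b = 0)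
    (h2 : minkowski b c = 0) : minkowski a c = 0 := by
  obtain ⟨a, rfl⟩ := exists_spin ha
  obtain ⟨b, rfl⟩ := exists_spin hb
  obtain ⟨c, rfl⟩ := exists_spin hc
  rw [minkowski_spin] at *
  have e1 : a.1 * b.2 - a.2 * b.1 = 0 := by
    rw [← sq_eq_zero_iff]; linarith
  have e2 : b.1 * c.2 - b.2 * c.1 = 0 := by
    rw [← sq_eq_zero_iff]; linarith
  have e3 : b.1 * (a.1 * c.2 - a.2 * c.1) = 0 := by linear_combination a.1 * e2 + c.1 * e1
  have e4 : b.2 * (a.1 * c.2 - a.2 * c.1) = 0 := by linear_combination a.2 * e2 + c.2 * e1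
  have hb2 : 0 < b.1 ^ 2 + b.2 ^ 2 := hb.2
  have e5 : (b.1 ^ 2 + b.2 ^ 2) * (a.1 * c.2 - a.2 * c.1) = 0 := by
    linear_combination b.1 * e3 + b.2 * e4
  rcases mul_eq_zero.1 e5 with h | h
  · exact absurd h hb2.ne'
  · rw [h]; ring

/-- The image of `v` has negative product with the image of `(0,0,1)`, which is future-pointing. By
Cauchy–Schwarz a past-pointing light-like vector would have non-negative product with it. -/
theorem mem_positiveLightCone_of_isometry (g : isometryGroup) {v : Fin 3 → ℝ}
    (hv : v ∈ positiveLightCone) : (g : GL (Fin 3) ℝ).1 *ᵥ v ∈ positiveLightCone := by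
  set M := (g : GL (Fin 3) ℝ).1
  have hM : ∀ v w, minkowski (M *ᵥ v) (M *ᵥ w) = minkowski v w := g.2.1
  have ho : (![0, 0, 1] : Fin 3 → ℝ) ∈ hyperbolicPlane := by simp [hyperbolicPlane, minkowski]
  obtain ⟨h1, h2⟩ := g.2.2 _ ho
  have h3 := (hM v v).trans hv.1
  have h4 := hM v ![0, 0, 1]
  have h5 : minkowski v ![0, 0, 1] = -v 2 := by simp [minkowski]
  rw [h5] at h4
  change minkowski (M *ᵥ ![0, 0, 1]) (M *ᵥ ![0, 0, 1]) = -1 at h1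
  change 0 < (M *ᵥ ![0, 0, 1]) 2 at h2
  generalize M *ᵥ ![0, 0, 1] = p at *
  generalize M *ᵥ v = w at *
  refine ⟨h3, ?_⟩
  have hv2 := hv.2
  simp only [minkowski] at h1 h3 h4
  by_contra hneg
  rw [not_lt] at hneg
  have h6 : (w 0 * p 0 + w 1 * p 1) ^ 2 ≤ (w 0 ^ 2 + w 1 ^ 2) * (p 0 ^ 2 + p 1 ^ 2) := by
    nlinarith [sq_nonneg (w 0 * p 1 - w 1 * p 0)]
  have h7 : w 0 * p 0 + w 1 * p 1 < w 2 * p 2 := by linarith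
  have h8 : w 2 * p 2 ≤ 0 := mul_nonpos_of_nonpos_of_nonneg hneg h2.le
  have h9 : (w 2 * p 2) ^ 2 < (w 0 * p 0 + w 1 * p 1) ^ 2 := by nlinarith
  rw [show w 0 ^ 2 + w 1 ^ 2 = w 2 ^ 2 by linarith,
    show p 0 ^ 2 + p 1 ^ 2 = p 2 ^ 2 - 1 by linarith] at h6
  nlinarith [sq_nonneg (w 2)]

/-- Two causal vectors with different directions have a definite product. -/
theorem kleinPoint_dist_le {a b : Fin 3 → ℝ} (ha : minkowski a a ≤ 0) (ha2 : 0 < a 2)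
    (hb : minkowski b b ≤ 0) (hb2 : 0 < b 2) :
    a 2 * b 2 * dist (kleinPoint a) (kleinPoint b) ^ 2 ≤ -2 * minkowski a b := by
  have key : a 2 * b 2 * ((a 0 / a 2 - b 0 / b 2) ^ 2 + (a 1 / a 2 - b 1 / b 2) ^ 2) ≤
      -2 * minkowski a b := by
    have e : -2 * minkowski a b -
        a 2 * b 2 * ((a 0 / a 2 - b 0 / b 2) ^ 2 + (a 1 / a 2 - b 1 / b 2) ^ 2) =
        -(b 2 / a 2 * minkowski a a) - (a 2 / b 2 * minkowski b b) := by
      simp only [minkowski]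
      field_simp
      ring
    have h1 : b 2 / a 2 * minkowski a a ≤ 0 :=
      mul_nonpos_of_nonneg_of_nonpos (by positivity) ha
    have h2 : a 2 / b 2 * minkowski b b ≤ 0 :=
      mul_nonpos_of_nonneg_of_nonpos (by positivity) hb
    linarith
  refine le_trans (mul_le_mul_of_nonneg_left ?_ (by positivity)) key
  simp only [kleinPoint, Prod.dist_eq, Real.dist_eq]
  rcases max_cases |a 0 / a 2 - b 0 / b 2| |a 1 / a 2 - b 1 / b 2| with ⟨h, -⟩ | ⟨h, -⟩ <;>
    rw [h, sq_abs]
  · linarith [sq_nonneg (a 1 / a 2 - b 1 / b 2)]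
  · linarith [sq_nonneg (a 0 / a 2 - b 0 / b 2)]

namespace DecoratedMetric

variable {π ι : Type*} [Group π] [Fintype ι] (m : DecoratedMetric π ι)

/-- The hyperbolic cosine of the displacement of the point `(0,0,1)` by `ρ(γ)`. -/
def coshDisp (γ : π) : ℝ := m.holMatrix γ 2 2

theorem holMatrix_one : m.holMatrix 1 = 1 := by simp [holMatrix]

theorem holMatrix_entries (γ : π) (i j : Fin 3) :
    m.holMatrix γ 0 i * m.holMatrix γ 0 j + m.holMatrix γ 1 i * m.holMatrix γ 1 j -
      m.holMatrix γ 2 i * m.holMatrix γ 2 j = minkowski (Pi.single i 1) (Pi.single j 1) := by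
  rw [← m.minkowski_holMatrix γ]
  simp [minkowski]

theorem coshDisp_pos (γ : π) : 0 < m.coshDisp γ := by
  have ho : (![0, 0, 1] : Fin 3 → ℝ) ∈ hyperbolicPlane := by simp [hyperbolicPlane, minkowski]
  have h := ((m.hol γ).2.2 _ ho).2
  simpa [coshDisp, holMatrix, mulVec, dotProduct, Fin.sum_univ_three] using h

theorem one_le_coshDisp (γ : π) : 1 ≤ m.coshDisp γ := by
  have h := m.holMatrix_entries γ 2 2
  have h2 := m.coshDisp_pos γ
  simp [minkowski] at h
  rw [coshDisp] at *
  nlinarith [sq_nonneg (m.holMatrix γ 0 2), sq_nonneg (m.holMatrix γ 1 2)]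

theorem coshDisp_one : m.coshDisp 1 = 1 := by simp [coshDisp, holMatrix_one]

theorem holMatrix_inv_col (γ : π) (i : Fin 3) :
    m.holMatrix γ⁻¹ i 2 ^ 2 = m.holMatrix γ 2 i ^ 2 := by
  have h := m.minkowski_holMatrix_inv γ (Pi.single i 1) (Pi.single 2 1)
  simp [minkowski] at h
  fin_cases i <;> simp at h ⊢
  · rw [← h]; ring
  · rw [← h]; ring
  · rw [← h]

theorem coshDisp_inv (γ : π) : m.coshDisp γ⁻¹ = m.coshDisp γ := by
  have h := m.holMatrix_inv_col γ 2
  exact (sq_eq_sq₀ (m.coshDisp_pos _).le (m.coshDisp_pos _).le).1 h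

/-- The columns are orthonormal for the form, and the last row is, up to signs, the last column of
the inverse. These relations bound every entry by the last diagonal one. -/
theorem abs_holMatrix_le (γ : π) (i j : Fin 3) : |m.holMatrix γ i j| ≤ m.coshDisp γ := by
  have hrow : m.holMatrix γ 2 0 ^ 2 + m.holMatrix γ 2 1 ^ 2 = m.holMatrix γ 2 2 ^ 2 - 1 := by
    have h := m.holMatrix_entries γ⁻¹ 2 2
    simp [minkowski] at h
    rw [← m.holMatrix_inv_col γ 0, ← m.holMatrix_inv_col γ 1, ← m.holMatrix_inv_col γ 2]
    linarith
  have h0 := m.holMatrix_entries γ 0 0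
  have h1 := m.holMatrix_entries γ 1 1
  have h2 := m.holMatrix_entries γ 2 2
  simp [minkowski] at h0 h1 h2
  refine abs_le_of_sq_le_sq ?_ (m.coshDisp_pos γ).le
  rw [coshDisp]
  generalize m.holMatrix γ = M at *
  fin_cases i <;> fin_cases j <;> simp only [Fin.zero_eta, Fin.mk_one, Fin.reduceFinMk] <;>
    nlinarith [sq_nonneg (M 0 0), sq_nonneg (M 0 1), sq_nonneg (M 0 2), sq_nonneg (M 1 0),
      sq_nonneg (M 1 1), sq_nonneg (M 1 2), sq_nonneg (M 2 0), sq_nonneg (M 2 1)]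

theorem coshDisp_mul_le (γ δ : π) :
    m.coshDisp (γ * δ) ≤ 3 * (m.coshDisp γ * m.coshDisp δ) := by
  rw [coshDisp, holMatrix_mul, Matrix.mul_apply, Fin.sum_univ_three]
  have h : ∀ k, m.holMatrix γ 2 k * m.holMatrix δ k 2 ≤ m.coshDisp γ * m.coshDisp δ := fun k => by
    refine (le_abs_self _).trans ?_
    rw [abs_mul]
    exact mul_le_mul (m.abs_holMatrix_le _ _ _) (m.abs_holMatrix_le _ _ _) (abs_nonneg _)
      (m.coshDisp_pos _).le
  linarith [h 0, h 1, h 2]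

theorem norm_holMatrix_mulVec_le (γ : π) (v : Fin 3 → ℝ) :
    ‖m.holMatrix γ *ᵥ v‖ ≤ 3 * (m.coshDisp γ * ‖v‖) := by
  have hA := (m.coshDisp_pos γ).le
  refine (pi_norm_le_iff_of_nonneg (by positivity)).2 fun i => ?_
  have h : ∀ k, |m.holMatrix γ i k * v k| ≤ m.coshDisp γ * ‖v‖ := fun k => by
    rw [abs_mul]
    exact mul_le_mul (m.abs_holMatrix_le _ _ _) (norm_le_pi_norm v k) (abs_nonneg _) hA
  rw [mulVec, dotProduct, Fin.sum_univ_three, Real.norm_eq_abs]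
  refine (abs_add_three _ _ _).trans ?_
  linarith [h 0, h 1, h 2]

/-- Bounded displacement bounds the entries of `ρ(γ)` and of its inverse, which confines `ρ(γ)` to a
compact subset of the general linear group. The image of `ρ` is discrete, hence closed, and meets it
in a finite set. -/
theorem finite_coshDisp_le (R : ℝ) : {γ : π | m.coshDisp γ ≤ R}.Finite := by
  set H : Subgroup (GL (Fin 3) ℝ) := m.hol.range.map isometryGroup.subtype with hH
  have hsub : ∀ h : H, ∃ x : m.hol.range, ((x : isometryGroup) : GL (Fin 3) ℝ) = h := by
    rintro ⟨_, x, hx, rfl⟩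
    exact ⟨⟨x, hx⟩, rfl⟩
  have hmem1 : ∀ h : H, (h : GL (Fin 3) ℝ) ∈ isometryGroup := fun h => by
    obtain ⟨x, hx⟩ := hsub h
    rw [← hx]; exact x.1.2
  have hmem2 : ∀ h : H, (⟨h, hmem1 h⟩ : isometryGroup) ∈ m.hol.range := fun h => by
    obtain ⟨x, hx⟩ := hsub h
    have : (⟨h, hmem1 h⟩ : isometryGroup) = x := Subtype.ext hx.symm
    rw [this]; exact x.2
  have := m.hol_discrete
  have hdisc : DiscreteTopology H := by
    refine DiscreteTopology.of_continuous_injective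
      (f := fun h : H => (⟨⟨h, hmem1 h⟩, hmem2 h⟩ : m.hol.range)) ?_ ?_
    · exact (continuous_subtype_val.subtype_mk _).subtype_mk _
    · intro a b hab
      exact Subtype.ext (congrArg (fun x : m.hol.range => (x.1 : GL (Fin 3) ℝ)) hab)
  have hclosed : IsClosed (H : Set (GL (Fin 3) ℝ)) := Subgroup.isClosed_of_discrete
  set B : Set (Matrix (Fin 3) (Fin 3) ℝ) :=
    Set.pi Set.univ fun _ => Set.pi Set.univ fun _ => Set.Icc (-R) R with hB
  have hBc : IsCompact B := isCompact_univ_pi fun _ => isCompact_univ_pi fun _ => isCompact_Icc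
  have hKc : IsCompact ((Units.embedProduct (Matrix (Fin 3) (Fin 3) ℝ)) ⁻¹'
      (B ×ˢ (MulOpposite.unop ⁻¹' B))) := by
    refine Units.isClosedEmbedding_embedProduct.isCompact_preimage (hBc.prod ?_)
    exact (MulOpposite.opHomeomorph.symm.isClosedEmbedding.isCompact_preimage hBc)
  have hfin : ((H : Set (GL (Fin 3) ℝ)) ∩ (Units.embedProduct (Matrix (Fin 3) (Fin 3) ℝ)) ⁻¹'
      (B ×ˢ (MulOpposite.unop ⁻¹' B))).Finite :=
    (hKc.inter_left hclosed).finite ((isDiscrete_iff_discreteTopology.2 hdisc).mono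
      Set.inter_subset_left)
  refine Set.Finite.of_finite_image (f := fun γ => (m.hol γ : GL (Fin 3) ℝ))
    (hfin.subset ?_) ?_
  · rintro _ ⟨γ, hγ, rfl⟩
    refine ⟨⟨m.hol γ, ⟨γ, rfl⟩, rfl⟩, ?_⟩
    have hγ' : m.coshDisp γ⁻¹ ≤ R := by rw [coshDisp_inv]; exact hγ
    refine ⟨fun i _ j _ => abs_le.1 ((m.abs_holMatrix_le γ i j).trans hγ), fun i _ j _ => ?_⟩
    have := abs_le.1 ((m.abs_holMatrix_le γ⁻¹ i j).trans hγ')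
    simpa [holMatrix] using this
  · intro a _ b _ hab
    exact m.hol_injective (Subtype.ext hab)

theorem lift_mem (a : π × ι) : m.lift a ∈ positiveLightCone :=
  mem_positiveLightCone_of_isometry (m.hol a.1) (m.spike_mem a.2)

/-- The image of the point `(0,0,1)` of the hyperbolic plane. -/
def basePoint (γ : π) : Fin 3 → ℝ := m.holMatrix γ *ᵥ ![0, 0, 1]

theorem basePoint_two (γ : π) : m.basePoint γ 2 = m.coshDisp γ := by
  simp [basePoint, coshDisp, mulVec, dotProduct, Fin.sum_univ_three]

theorem minkowski_basePoint_self (γ : π) : minkowski (m.basePoint γ) (m.basePoint γ) ≤ 0 := by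
  rw [basePoint, m.minkowski_holMatrix]; simp [minkowski]

theorem exists_far_from_spike (j : ι) : ∃ e : ℝ, 0 < e ∧
    ∀ᶠ γ in cofinite, e ≤ dist (kleinPoint (m.basePoint γ)) (kleinPoint (m.spike j)) := by
  have h := m.spike_not_limit j
  rw [IsLimitPoint, mapClusterPt_iff_frequently] at h
  push Not at h
  obtain ⟨s, hs, h⟩ := h
  obtain ⟨e, he, hes⟩ := Metric.mem_nhds_iff.1 hs
  refine ⟨e, he, h.mono fun γ hγ => ?_⟩
  by_contra hlt
  exact hγ (hes (not_le.1 hlt))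

theorem exists_basePoint_lower (j : ι) : ∃ c : ℝ, 0 < c ∧
    ∀ᶠ γ in cofinite, c * m.coshDisp γ ≤ -minkowski (m.basePoint γ) (m.spike j) := by
  obtain ⟨e, he, h⟩ := m.exists_far_from_spike j
  have hv := m.spike_mem j
  have hv2 := hv.2
  refine ⟨m.spike j 2 * e ^ 2 / 2, by positivity, h.mono fun γ hγ => ?_⟩
  have hA := m.coshDisp_pos γ
  have key := kleinPoint_dist_le (m.minkowski_basePoint_self γ) (by rwa [basePoint_two]) hv.1.le hv2
  rw [basePoint_two] at key
  have h2 : e ^ 2 ≤ dist (kleinPoint (m.basePoint γ)) (kleinPoint (m.spike j)) ^ 2 := by gcongr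
  have h3 := mul_le_mul_of_nonneg_left h2 (mul_pos hA hv2).le
  linarith

/-- The last coordinate of `ρ(γ)v_i` is minus the product of `ρ(γ⁻¹)(0,0,1)` with `v_i`, so
`exists_basePoint_lower` applies to `γ⁻¹`. -/
theorem exists_lift_two_lower (i : ι) : ∃ c : ℝ, 0 < c ∧
    ∀ᶠ γ in cofinite, c * m.coshDisp γ ≤ m.lift (γ, i) 2 := by
  obtain ⟨c, hc, h⟩ := m.exists_basePoint_lower i
  have ht : Tendsto (fun γ : π => γ⁻¹) cofinite cofinite := inv_injective.tendsto_cofinite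
  refine ⟨c, hc, (ht.eventually h).mono fun γ hγ => ?_⟩
  rw [coshDisp_inv, basePoint, minkowski_holMatrix_inv, inv_inv] at hγ
  refine hγ.trans (le_of_eq ?_)
  simp [minkowski, lift]

theorem tendsto_coshDisp : Tendsto m.coshDisp cofinite atTop := by
  refine tendsto_atTop.2 fun R => ?_
  refine (m.finite_coshDisp_le R).subset fun γ hγ => ?_
  exact (not_le.1 (show ¬ R ≤ m.coshDisp γ from hγ)).le

/-- As the spikes lie outside of the limit set, the product of a spike with the translates of a spike
grows like the translation. -/
theorem exists_spike_lower (i j : ι) : ∃ c : ℝ, 0 < c ∧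
    ∀ᶠ γ in cofinite, c * m.coshDisp γ ≤ -minkowski (m.lift (γ, i)) (m.spike j) := by
  obtain ⟨c, hc, h1⟩ := m.exists_lift_two_lower i
  obtain ⟨e, he, h2⟩ := m.exists_far_from_spike j
  have hv := m.spike_mem j
  have hv2 := hv.2
  have hw2 := (m.spike_mem i).2
  have h3 := m.tendsto_coshDisp.eventually_ge_atTop (8 * m.spike i 2 / (c * e ^ 2))
  refine ⟨c * m.spike j 2 * (e / 2) ^ 2 / 2, by positivity, ?_⟩
  filter_upwards [h1, h2, h3] with γ h1 h2 h3
  have hA := m.coshDisp_pos γ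
  have hA1 := m.one_le_coshDisp γ
  have hl := m.lift_mem (γ, i)
  have hl2 : 0 < m.lift (γ, i) 2 := hl.2
  have k1 := kleinPoint_dist_le (m.minkowski_basePoint_self γ) (by rwa [basePoint_two]) hl.1.le hl2
  rw [basePoint_two, basePoint, lift, minkowski_holMatrix, ← basePoint, ← lift] at k1
  have k2 : minkowski ![0, 0, 1] (m.spike i) = -m.spike i 2 := by simp [minkowski]
  rw [k2] at k1
  -- The two vectors have a constant product while their last coordinates grow, so their directions
  -- converge. The threshold in `h3` makes the distance at most `e / 2`, and the spike `j` stays at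
  -- distance `e / 2` from the translate.
  have k3 : dist (kleinPoint (m.basePoint γ)) (kleinPoint (m.lift (γ, i))) ≤ e / 2 := by
    refine le_of_sq_le_sq ?_ (by positivity) |>.trans le_rfl
    have k4 : c * m.coshDisp γ * dist (kleinPoint (m.basePoint γ)) (kleinPoint (m.lift (γ, i))) ^ 2
        ≤ 2 * m.spike i 2 := by
      have k5 : c * m.coshDisp γ ≤ m.coshDisp γ * m.lift (γ, i) 2 := by nlinarith
      nlinarith [sq_nonneg (dist (kleinPoint (m.basePoint γ)) (kleinPoint (m.lift (γ, i))))]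
    rw [div_le_iff₀ (by positivity)] at h3
    have k6 : c * m.coshDisp γ * dist (kleinPoint (m.basePoint γ)) (kleinPoint (m.lift (γ, i))) ^ 2
        ≤ c * m.coshDisp γ * (e / 2) ^ 2 := by nlinarith
    exact le_of_mul_le_mul_left k6 (by positivity)
  have k7 : e / 2 ≤ dist (kleinPoint (m.lift (γ, i))) (kleinPoint (m.spike j)) := by
    have := dist_triangle (kleinPoint (m.basePoint γ)) (kleinPoint (m.lift (γ, i)))
      (kleinPoint (m.spike j))
    linarith
  have k8 := kleinPoint_dist_le hl.1.le hl2 hv.1.le hv2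
  have k9 : (e / 2) ^ 2 ≤ dist (kleinPoint (m.lift (γ, i))) (kleinPoint (m.spike j)) ^ 2 := by
    gcongr
  have k10 := mul_le_mul (mul_le_mul_of_nonneg_right h1 hv2.le) k9 (by positivity) (by positivity)
  linarith

theorem lift_mul (γ δ : π) (i : ι) : m.lift (γ * δ, i) = m.holMatrix γ *ᵥ m.lift (δ, i) := by
  simp only [lift, holMatrix_mul, mulVec_mulVec]

theorem minkowski_lift_mul (γ : π) (a b : π × ι) :
    minkowski (m.lift (γ * a.1, a.2)) (m.lift (γ * b.1, b.2)) = minkowski (m.lift a) (m.lift b) := by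
  rw [lift_mul, lift_mul, minkowski_holMatrix]

theorem minkowski_lift_lift (γ δ : π) (i j : ι) :
    minkowski (m.lift (γ, i)) (m.lift (δ, j)) =
      minkowski (m.lift (γ⁻¹ * δ, j)) (m.spike i) := by
  rw [← m.minkowski_lift_mul γ⁻¹]
  simp only [inv_mul_cancel]
  rw [minkowski_comm]
  congr 1
  simp [lift, holMatrix_one]

theorem lift_one (i : ι) : m.lift (1, i) = m.spike i := by simp [lift, holMatrix_one]

theorem pow_injective_of_ne_one (m : DecoratedMetric π ι) {γ : π} (hγ : γ ≠ 1) :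
    Function.Injective fun n : ℕ => γ ^ n := by
  obtain ⟨c, hc, p, hp, hgp⟩ := m.hol_hyperbolic γ hγ
  have h : ∀ n : ℕ, m.holMatrix (γ ^ n) *ᵥ p = c ^ n • p := by
    intro n
    induction n with
    | zero => simp [holMatrix_one]
    | succ n ih =>
      rw [pow_succ, holMatrix_mul, ← mulVec_mulVec]
      have : m.holMatrix γ *ᵥ p = c • p := hgp
      rw [this, mulVec_smul, ih, smul_smul, pow_succ, mul_comm]
  intro a b hab
  have h1 := congrFun ((h a).symm.trans ((congrArg (fun g => m.holMatrix g *ᵥ p) hab).trans (h b))) 2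
  simp only [Pi.smul_apply, smul_eq_mul] at h1
  exact pow_right_injective₀ (by linarith) hc.ne' (mul_right_cancel₀ hp.2.ne' h1)

/-- The stabilizer of a spike is trivial. -/
theorem minkowski_lift_ne_zero {γ : π} (hγ : γ ≠ 1) (i : ι) :
    minkowski (m.lift (γ, i)) (m.spike i) ≠ 0 := by
  intro h0
  obtain ⟨c, hc, h⟩ := m.exists_spike_lower i i
  -- If `γ` fixes the ideal point, so do its infinitely many powers, against the growth of the
  -- products.
  have hall : ∀ n : ℕ, minkowski (m.lift (γ ^ n, i)) (m.spike i) = 0 := by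
    intro n
    induction n with
    | zero => rw [pow_zero, lift_one]; exact (m.spike_mem i).1
    | succ n ih =>
      refine minkowski_eq_zero_trans (m.lift_mem _) (m.lift_mem (γ ^ n, i)) (m.spike_mem i) ?_ ih
      rw [minkowski_comm, minkowski_lift_lift, pow_succ, inv_mul_cancel_left, h0]
  obtain ⟨n, hn⟩ := ((m.pow_injective_of_ne_one hγ).tendsto_cofinite.eventually h).exists
  rw [hall] at hn
  have := m.coshDisp_pos (γ ^ n)
  have := mul_pos hc this
  linarith

theorem minkowski_lift_lift_ne_zero {γ δ : π} (h : γ ≠ δ) (i : ι) :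
    minkowski (m.lift (γ, i)) (m.lift (δ, i)) ≠ 0 := by
  rw [minkowski_lift_lift]
  exact m.minkowski_lift_ne_zero (fun e => h (inv_mul_eq_one.1 e)) i

/-- The finitely many exceptions to `exists_spike_lower` have positive products, as stabilizers are
trivial. With `minkowski_lift_upper`, squared `λ`-lengths within one orbit become comparable to
displacements. -/
theorem exists_orbit_lower (i : ι) : ∃ c : ℝ, 0 < c ∧ ∀ γ : π, γ ≠ 1 →
    c * m.coshDisp γ ≤ -minkowski (m.lift (γ, i)) (m.spike i) := by
  obtain ⟨c, hc, h⟩ := m.exists_spike_lower i i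
  set E := {γ : π | ¬ c * m.coshDisp γ ≤ -minkowski (m.lift (γ, i)) (m.spike i)} with hE
  have hEf : E.Finite := h
  have hpos : ∀ γ : π, γ ≠ 1 → 0 < -minkowski (m.lift (γ, i)) (m.spike i) := fun γ hγ =>
    lt_of_le_of_ne (neg_nonneg.2 (minkowski_nonpos (m.lift_mem _) (m.spike_mem i)))
      (neg_ne_zero.2 (m.minkowski_lift_ne_zero hγ i)).symm
  obtain ⟨C, hC⟩ := (hEf.image fun γ =>
    m.coshDisp γ / -minkowski (m.lift (γ, i)) (m.spike i)).bddAbove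
  set C' := max C 1
  have hC' : 0 < C' := lt_of_lt_of_le one_pos (le_max_right _ _)
  refine ⟨min c C'⁻¹, lt_min hc (inv_pos.2 hC'), fun γ hγ => ?_⟩
  have hA := (m.coshDisp_pos γ).le
  by_cases hγE : γ ∈ E
  · refine (mul_le_mul_of_nonneg_right (min_le_right _ _) hA).trans ?_
    have h1 := (hC (Set.mem_image_of_mem _ hγE)).trans (le_max_left C 1)
    rw [div_le_iff₀ (hpos γ hγ)] at h1
    rw [inv_mul_le_iff₀ hC']
    exact h1
  · exact (mul_le_mul_of_nonneg_right (min_le_left _ _) hA).trans (not_not.1 hγE)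

theorem minkowski_lift_upper (i j : ι) : ∃ C : ℝ, 0 < C ∧ ∀ γ : π,
    -minkowski (m.lift (γ, i)) (m.spike j) ≤ C * m.coshDisp γ := by
  refine ⟨9 * (‖m.spike i‖ * ‖m.spike j‖) + 1, by positivity, fun γ => ?_⟩
  have h1 := abs_minkowski_le (m.lift (γ, i)) (m.spike j)
  have h2 := m.norm_holMatrix_mulVec_le γ (m.spike i)
  have h3 := mul_le_mul_of_nonneg_right h2 (norm_nonneg (m.spike j))
  have h4 := neg_le_abs (minkowski (m.lift (γ, i)) (m.spike j))
  have h5 := m.coshDisp_pos γ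
  rw [lift] at *
  linarith

theorem lam_lift_sq (i : ι) (γ δ : π) : lam (m.lift (γ, i)) (m.lift (δ, i)) ^ 2 =
    -minkowski (m.lift (γ⁻¹ * δ, i)) (m.spike i) := by
  rw [lam_sq (m.lift_mem _) (m.lift_mem _), minkowski_lift_lift]

/-- The four-point inequality, which expresses that the hyperbolic plane is hyperbolic. -/
theorem exists_four_point : ∃ C : ℝ, 0 < C ∧ ∀ a b c y : π,
    m.coshDisp (c⁻¹ * y) * m.coshDisp (a⁻¹ * b) ≤
      C * (m.coshDisp (c⁻¹ * a) * m.coshDisp (y⁻¹ * b) +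
        m.coshDisp (c⁻¹ * b) * m.coshDisp (a⁻¹ * y)) := by
  obtain ⟨i⟩ := m.nonempty_spikes
  obtain ⟨k, hk, hlow⟩ := m.exists_orbit_lower i
  obtain ⟨K, hK, hup⟩ := m.minkowski_lift_upper i i
  have hA : ∀ γ, 0 < m.coshDisp γ := m.coshDisp_pos
  refine ⟨2 * K ^ 2 / k ^ 2 + 3, by positivity, fun a b c y => ?_⟩
  have htri : ∀ a b c : π, m.coshDisp (a⁻¹ * c) ≤
      3 * (m.coshDisp (a⁻¹ * b) * m.coshDisp (b⁻¹ * c)) := fun a b c => by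
    have h := m.coshDisp_mul_le (a⁻¹ * b) (b⁻¹ * c)
    rwa [mul_assoc, mul_inv_cancel_left] at h
  have hsymm : ∀ a b : π, m.coshDisp (a⁻¹ * b) = m.coshDisp (b⁻¹ * a) := fun a b => by
    rw [← coshDisp_inv, _root_.mul_inv_rev, inv_inv]
  have hp1 := mul_pos (hA (c⁻¹ * a)) (hA (y⁻¹ * b))
  have hp2 := mul_pos (hA (c⁻¹ * b)) (hA (a⁻¹ * y))
  have hkK : 0 ≤ 2 * K ^ 2 / k ^ 2 := by positivity
  have hnn := mul_nonneg hkK (add_pos hp1 hp2).le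
  -- In the degenerate cases the lower bound of `exists_orbit_lower` is missing; the triangle
  -- inequality replaces it and accounts for the `+ 3` in the constant.
  by_cases hcy : c = y
  · subst hcy
    rw [inv_mul_cancel, coshDisp_one, one_mul]
    have h := htri a c b
    rw [hsymm a c] at h
    nlinarith
  by_cases hab : a = b
  · subst hab
    rw [inv_mul_cancel, coshDisp_one, mul_one]
    have h := htri c a y
    nlinarith
  have hP := lam_ptolemy_le (m.lift_mem (c, i)) (m.lift_mem (a, i)) (m.lift_mem (y, i))
    (m.lift_mem (b, i))
  have l1 : k * m.coshDisp (c⁻¹ * y) ≤ lam (m.lift (c, i)) (m.lift (y, i)) ^ 2 := by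
    rw [lam_lift_sq]; exact hlow _ fun e => hcy (inv_mul_eq_one.1 e)
  have l2 : k * m.coshDisp (a⁻¹ * b) ≤ lam (m.lift (a, i)) (m.lift (b, i)) ^ 2 := by
    rw [lam_lift_sq]; exact hlow _ fun e => hab (inv_mul_eq_one.1 e)
  have u : ∀ x z, lam (m.lift (x, i)) (m.lift (z, i)) ^ 2 ≤ K * m.coshDisp (x⁻¹ * z) :=
    fun x z => by rw [lam_lift_sq]; exact hup _
  have q1 := mul_le_mul l1 l2 (mul_pos hk (hA _)).le (sq_nonneg _)
  have q2 := mul_le_mul (u c a) (u y b) (sq_nonneg _) (mul_pos hK (hA _)).le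
  have q3 := mul_le_mul (u a y) (u c b) (sq_nonneg _) (mul_pos hK (hA _)).le
  have hP2 := pow_le_pow_left₀ (mul_nonneg (lam_nonneg _ _) (lam_nonneg _ _)) hP 2
  have hP3 : (lam (m.lift (c, i)) (m.lift (a, i)) * lam (m.lift (y, i)) (m.lift (b, i)) +
      lam (m.lift (a, i)) (m.lift (y, i)) * lam (m.lift (c, i)) (m.lift (b, i))) ^ 2 ≤
      2 * ((lam (m.lift (c, i)) (m.lift (a, i)) * lam (m.lift (y, i)) (m.lift (b, i))) ^ 2 +
      (lam (m.lift (a, i)) (m.lift (y, i)) * lam (m.lift (c, i)) (m.lift (b, i))) ^ 2) := add_sq_le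
  simp only [mul_pow] at hP2 hP3
  have h5 : k ^ 2 * (m.coshDisp (c⁻¹ * y) * m.coshDisp (a⁻¹ * b)) ≤
      2 * K ^ 2 * (m.coshDisp (c⁻¹ * a) * m.coshDisp (y⁻¹ * b) +
        m.coshDisp (c⁻¹ * b) * m.coshDisp (a⁻¹ * y)) := by linarith
  have h6 : m.coshDisp (c⁻¹ * y) * m.coshDisp (a⁻¹ * b) ≤
      2 * K ^ 2 / k ^ 2 * (m.coshDisp (c⁻¹ * a) * m.coshDisp (y⁻¹ * b) +
        m.coshDisp (c⁻¹ * b) * m.coshDisp (a⁻¹ * y)) := by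
    rw [div_mul_eq_mul_div, le_div_iff₀ (by positivity)]
    linarith
  linarith

/-- Cyclic subgroups are undistorted, as they act by translations along geodesics. -/
theorem exists_cyclic_bound (g : π) (hg : g ≠ 1) : ∃ C : ℝ, ∀ a b : ℕ,
    m.coshDisp (g ^ a) * m.coshDisp (g ^ b) ≤ C * m.coshDisp (g ^ (a + b)) := by
  obtain ⟨i⟩ := m.nonempty_spikes
  obtain ⟨k, hk, hlow⟩ := m.exists_orbit_lower i
  obtain ⟨c, hc, p, hp, hgp⟩ := m.hol_hyperbolic g hg
  replace hgp : m.holMatrix g *ᵥ p = c • p := hgp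
  have hc0 : 0 < c := by linarith
  set μ := √c with hμ
  have hμ1 : 1 < μ := Real.lt_sqrt_of_sq_lt (by linarith)
  have hμ0 : 0 < μ := by linarith
  have hμc : μ ^ 2 = c := Real.sq_sqrt hc0.le
  have hpow : ∀ n : ℕ, m.holMatrix (g ^ n) *ᵥ p = c ^ n • p := by
    intro n
    induction n with
    | zero => simp [holMatrix_one]
    | succ n ih =>
      rw [pow_succ, holMatrix_mul, ← mulVec_mulVec, hgp, mulVec_smul, ih, smul_smul, pow_succ,
        mul_comm]
  have hsmul : ∀ (r : ℝ) (v : Fin 3 → ℝ), minkowski v (r • p) = r * minkowski v p := by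
    intro r v; simp [minkowski]; ring
  have hmp : ∀ n : ℕ, c ^ n * minkowski (m.lift (g ^ n, i)) p = minkowski (m.spike i) p := by
    intro n
    rw [← hsmul, ← hpow, lift, minkowski_holMatrix]
  -- Otherwise `g` would fix the ideal point of the spike, whose stabilizer is trivial.
  have hvp : minkowski (m.spike i) p ≠ 0 := by
    intro h0
    have h1 : minkowski (m.lift (g, i)) p = 0 := by
      have := hmp 1
      rw [pow_one, pow_one, h0] at this
      rcases mul_eq_zero.1 this with h | h
      · exact absurd h hc0.ne'
      · exact h
    rw [minkowski_comm] at h0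
    exact m.minkowski_lift_ne_zero hg i
      (minkowski_eq_zero_trans (m.lift_mem _) hp (m.spike_mem i) h1 h0)
  set P := lam (m.spike i) p with hP
  have hPpos : 0 < P := by
    rw [hP, lam]
    exact Real.sqrt_pos.2 (lt_of_le_of_ne (neg_nonneg.2 (minkowski_nonpos (m.spike_mem i) hp))
      (neg_ne_zero.2 hvp).symm)
  have hlp : ∀ n : ℕ, μ ^ n * lam (m.lift (g ^ n, i)) p = P := by
    intro n
    have h1 : 0 ≤ μ ^ n * lam (m.lift (g ^ n, i)) p := mul_nonneg (by positivity) (lam_nonneg _ _)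
    rw [← sq_eq_sq₀ h1 hPpos.le, mul_pow, lam_sq (m.lift_mem _) hp, hP, lam_sq (m.spike_mem i) hp,
      ← pow_mul, mul_comm n 2, pow_mul, hμc, ← hmp n]
    ring
  set x : ℕ → ℝ := fun n => lam (m.spike i) (m.lift (g ^ n, i)) with hx
  -- Ptolemy's inequality for `v`, `gv`, `g^(n+1)v` and the fixed vector `p`, whose `λ`-lengths to
  -- `g^n v` scale like `μ ^ (-n)`.
  have hrec : ∀ n : ℕ, μ ^ n * x (n + 1) ≤ x 1 + μ ^ (n + 1) * x n := by
    intro n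
    have h := lam_ptolemy_le (m.spike_mem i) (m.lift_mem (g, i)) (m.lift_mem (g ^ (n + 1), i)) hp
    have e1 : lam (m.lift (g, i)) (m.lift (g ^ (n + 1), i)) = x n := by
      refine congrArg (fun y => √(-y)) ?_
      rw [minkowski_lift_lift, minkowski_comm (m.spike i), pow_succ', inv_mul_cancel_left]
    have e2 := hlp 1
    have e3 := hlp (n + 1)
    rw [pow_one, pow_one] at e2
    rw [e1] at h
    have e4 : x 1 = lam (m.spike i) (m.lift (g, i)) := by rw [hx]; simp
    rw [← e4] at h
    change x (n + 1) * _ ≤ x 1 * _ + x n * P at h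
    have h2 := mul_le_mul_of_nonneg_left h (by positivity : 0 ≤ μ ^ (n + 1))
    have h3 : (μ ^ n * x (n + 1)) * P ≤ (x 1 + μ ^ (n + 1) * x n) * P := by
      calc (μ ^ n * x (n + 1)) * P = μ ^ (n + 1) * (x (n + 1) * lam (m.lift (g, i)) p) := by
            rw [← e2]; ring
        _ ≤ _ := h2
        _ = x 1 * (μ ^ (n + 1) * lam (m.lift (g ^ (n + 1), i)) p) + μ ^ (n + 1) * x n * P := by ring
        _ = _ := by rw [e3]; ring
    exact le_of_mul_le_mul_right h3 hPpos
  have hx0 : ∀ n, 0 ≤ x n := fun n => lam_nonneg _ _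
  -- Chosen so that `d * μ * (μ ^ n - μ ^ (-n))` solves the recursion with equality, starting from
  -- `x 0 = 0`.
  set d := x 1 / (μ ^ 2 - 1) with hd
  have hμ2 : 0 < μ ^ 2 - 1 := by nlinarith
  have hd0 : 0 ≤ d := div_nonneg (hx0 1) hμ2.le
  have hd1 : d * (μ ^ 2 - 1) = x 1 := div_mul_cancel₀ _ hμ2.ne'
  have hxn : ∀ n : ℕ, μ ^ n * x n ≤ d * μ * ((μ ^ n) ^ 2 - 1) := by
    intro n
    induction n with
    | zero =>
      have : x 0 = 0 := by
        rw [hx]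
        simp only [pow_zero, lift_one, lam, (m.spike_mem i).1, neg_zero, Real.sqrt_zero]
      rw [this]; simp
    | succ n ih =>
      have h1 := mul_le_mul_of_nonneg_left (hrec n) hμ0.le
      have h2 := mul_le_mul_of_nonneg_left ih (sq_nonneg μ)
      have e : d * μ * ((μ ^ (n + 1)) ^ 2 - 1) = μ * x 1 + μ ^ 2 * (d * μ * ((μ ^ n) ^ 2 - 1)) := by
        rw [← hd1]; ring
      rw [e]
      calc μ ^ (n + 1) * x (n + 1) = μ * (μ ^ n * x (n + 1)) := by ring
        _ ≤ μ * (x 1 + μ ^ (n + 1) * x n) := h1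
        _ = μ * x 1 + μ ^ 2 * (μ ^ n * x n) := by ring
        _ ≤ _ := by linarith
  have hxle : ∀ n : ℕ, x n ≤ d * μ * μ ^ n := by
    intro n
    have hn : 0 < μ ^ n := by positivity
    have h : μ ^ n * x n ≤ μ ^ n * (d * μ * μ ^ n) := by
      have := mul_nonneg hd0 hμ0.le
      nlinarith [hxn n]
    exact le_of_mul_le_mul_left h hn
  have hAup : ∀ n : ℕ, m.coshDisp (g ^ n) ≤ ((d * μ) ^ 2 / k + 1) * c ^ n := by
    intro n
    have hcn : 1 ≤ c ^ n := one_le_pow₀ hc.le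
    by_cases hn : g ^ n = 1
    · rw [hn, coshDisp_one]
      have : 0 ≤ (d * μ) ^ 2 / k := by positivity
      nlinarith
    · have h1 := hlow _ hn
      have h2 : -minkowski (m.lift (g ^ n, i)) (m.spike i) = x n ^ 2 := by
        rw [hx, lam_sq (m.spike_mem i) (m.lift_mem _), minkowski_comm]
      have h3 := pow_le_pow_left₀ (hx0 n) (hxle n) 2
      have h4 : (d * μ * μ ^ n) ^ 2 = (d * μ) ^ 2 * c ^ n := by
        rw [mul_pow, ← hμc]; ring
      rw [h2] at h1
      rw [h4] at h3
      have h5 : m.coshDisp (g ^ n) ≤ (d * μ) ^ 2 * c ^ n / k := by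
        rw [le_div_iff₀ hk]; linarith
      calc _ ≤ _ := h5
        _ = (d * μ) ^ 2 / k * c ^ n := by ring
        _ ≤ _ := by nlinarith
  -- The eigenvalue `c ^ n` bounds the size of the matrix from below; so displacement is comparable
  -- to `c ^ n`, which is multiplicative in `n`.
  have hAlow : ∀ n : ℕ, c ^ n * p 2 ≤ 3 * ‖p‖ * m.coshDisp (g ^ n) := by
    intro n
    have h1 := norm_le_pi_norm (m.holMatrix (g ^ n) *ᵥ p) 2
    have h2 := m.norm_holMatrix_mulVec_le (g ^ n) p
    rw [hpow] at h1 h2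
    have h3 : (c ^ n • p) 2 = c ^ n * p 2 := rfl
    rw [h3, Real.norm_eq_abs] at h1
    have h4 := le_abs_self (c ^ n * p 2)
    linarith
  have hp2 := hp.2
  refine ⟨((d * μ) ^ 2 / k + 1) ^ 2 * (3 * ‖p‖ / p 2), fun a b => ?_⟩
  have h1 := mul_le_mul (hAup a) (hAup b) (m.coshDisp_pos _).le (by positivity)
  have h2 : c ^ (a + b) ≤ 3 * ‖p‖ / p 2 * m.coshDisp (g ^ (a + b)) := by
    rw [div_mul_eq_mul_div, le_div_iff₀ hp2]
    exact hAlow _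
  calc _ ≤ _ := h1
    _ = ((d * μ) ^ 2 / k + 1) ^ 2 * c ^ (a + b) := by rw [pow_add]; ring
    _ ≤ ((d * μ) ^ 2 / k + 1) ^ 2 * (3 * ‖p‖ / p 2 * m.coshDisp (g ^ (a + b))) := by gcongr
    _ = _ := by ring

end DecoratedMetric

/-! ### The graph of minimal spanning trees -/

/-- The graph of all edges of length less than `w`. -/
def shorterGraph {V : Type*} (l : V → V → ℝ) (hl : ∀ a b, l a b = l b a) (w : ℝ) : SimpleGraph V where
  Adj a b := a ≠ b ∧ l a b < w
  symm := ⟨fun a b h => ⟨h.1.symm, hl a b ▸ h.2⟩⟩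
  loopless := ⟨fun _ h => h.1 rfl⟩

/-- The edges of length at most `L` whose endpoints are not connected by shorter edges, that is, all
edges that occur in a minimal spanning tree. -/
def spanningGraph {V : Type*} (l : V → V → ℝ) (hl : ∀ a b, l a b = l b a) (L : ℝ) :
    SimpleGraph V where
  Adj a b := a ≠ b ∧ l a b ≤ L ∧ ¬ (shorterGraph l hl (l a b)).Reachable a b
  symm := ⟨fun a b h => ⟨h.1.symm, hl a b ▸ h.2.1, fun h' => h.2.2 (by rw [hl a b]; exact h'.symm)⟩⟩
  loopless := ⟨fun _ h => h.1 rfl⟩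

theorem reachable_of_adj_reachable {V : Type*} {G H : SimpleGraph V} {a b : V}
    (h : G.Reachable a b) (hGH : ∀ u v, G.Adj u v → H.Reachable u v) : H.Reachable a b := by
  obtain ⟨p⟩ := h
  induction p with
  | nil => exact SimpleGraph.Reachable.refl _
  | cons h _ ih => exact (hGH _ _ h).trans ih

/-- Induction on the number of lengths below `l a b`: an edge that is not itself kept can be
replaced by a path of strictly shorter ones. -/
theorem spanningGraph_reachable {V : Type*} (l : V → V → ℝ) (hl : ∀ a b, l a b = l b a) {L : ℝ}
    (hfin : {x | x ≤ L ∧ ∃ a b, l a b = x}.Finite) {a b : V} (hab : l a b ≤ L) :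
    (spanningGraph l hl L).Reachable a b := by
  classical
  have key : ∀ (n : ℕ) (a b : V), l a b ≤ L →
      (hfin.toFinset.filter (· < l a b)).card < n → (spanningGraph l hl L).Reachable a b := by
    intro n
    induction n with
    | zero => intro a b _ h; exact absurd h (Nat.not_lt_zero _)
    | succ n ih =>
      intro a b hab hn
      by_cases e : a = b
      · rw [e]
      by_cases hr : (shorterGraph l hl (l a b)).Reachable a b
      · refine reachable_of_adj_reachable hr fun u v huv => ?_
        have huL : l u v ≤ L := huv.2.le.trans hab
        refine ih u v huL (lt_of_lt_of_le (Finset.card_lt_card ?_) (Nat.lt_succ_iff.1 hn))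
        rw [Finset.ssubset_iff_of_subset]
        · refine ⟨l u v, ?_, ?_⟩
          · rw [Finset.mem_filter, Set.Finite.mem_toFinset]
            exact ⟨⟨huL, u, v, rfl⟩, huv.2⟩
          · rw [Finset.mem_filter]
            exact fun h => lt_irrefl _ h.2
        · intro x hx
          rw [Finset.mem_filter] at hx ⊢
          exact ⟨hx.1, hx.2.trans huv.2⟩
      · exact SimpleGraph.Adj.reachable ⟨e, hab, hr⟩
  exact key _ a b hab (Nat.lt_succ_self _)

/-- Around the quadrilateral `abcd`, each path replacing the longer diagonal `bd` has a side at
least as long as `bd`. If these two sides are opposite, Ptolemy's equality leaves no room for the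
other product. If they are adjacent, it makes the other two sides a path of edges shorter than `ac`.
-/
theorem spanningGraph_noncrossing_aux {V : Type*} (l : V → V → ℝ) (hl : ∀ a b, l a b = l b a)
    (hpos : ∀ a b, a ≠ b → 0 < l a b) {L : ℝ} {a b c d : V} (hab : a ≠ b) (hbc : b ≠ c)
    (hcd : c ≠ d) (had : a ≠ d) (hP : l a c * l b d = l a b * l c d + l b c * l a d)
    (hle : l a c ≤ l b d) (h1 : (spanningGraph l hl L).Adj a c)
    (h2 : (spanningGraph l hl L).Adj b d) : False := by
  have pab := hpos _ _ hab
  have pbc := hpos _ _ hbc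
  have pcd := hpos _ _ hcd
  have pad := hpos _ _ had
  have pac := hpos _ _ h1.1
  have path : ∀ (w : ℝ) (x y z : V), x ≠ y → y ≠ z → l x y < w → l y z < w →
      (shorterGraph l hl w).Reachable x z := fun w x y z h1 h2 h3 h4 =>
    (SimpleGraph.Adj.reachable (G := shorterGraph l hl w) ⟨h1, h3⟩).trans
      (SimpleGraph.Adj.reachable ⟨h2, h4⟩)
  have k1 : l b d ≤ l a b ∨ l b d ≤ l a d := by
    by_contra h
    push Not at h
    exact h2.2.2 (path _ b a d hab.symm had (hl a b ▸ h.1) h.2)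
  have k2 : l b d ≤ l b c ∨ l b d ≤ l c d := by
    by_contra h
    push Not at h
    exact h2.2.2 (path _ b c d hbc hcd h.1 h.2)
  have pbd : 0 < l b d := pac.trans_le hle
  rcases k1 with k1 | k1 <;> rcases k2 with k2 | k2
  · have h3 : l b d * (l c d + l a d) ≤ l b d * l a c := by nlinarith
    have h4 := le_of_mul_le_mul_left h3 pbd
    exact h1.2.2 (path _ a d c had hcd.symm (by linarith) (by rw [hl d c]; linarith))
  · nlinarith [mul_pos pbc pad]
  · nlinarith [mul_pos pab pcd]
  · have h3 : l b d * (l a b + l b c) ≤ l b d * l a c := by nlinarith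
    have h4 := le_of_mul_le_mul_left h3 pbd
    exact h1.2.2 (path _ a b c hab hbc (by linarith) (by linarith))

/-- The edges of minimal spanning trees with respect to `λ`-lengths do not cross. -/
theorem spanningGraph_noncrossing {V : Type*} {vec : V → Fin 3 → ℝ}
    (hcone : ∀ a, vec a ∈ positiveLightCone)
    (hne : ∀ a b, a ≠ b → minkowski (vec a) (vec b) ≠ 0) {L : ℝ}
    (hl : ∀ a b, lam (vec a) (vec b) = lam (vec b) (vec a)) {a c b d : V}
    (h1 : (spanningGraph (fun a b => lam (vec a) (vec b)) hl L).Adj a c)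
    (h2 : (spanningGraph (fun a b => lam (vec a) (vec b)) hl L).Adj b d) :
    ¬ Crosses (vec a) (vec c) (vec b) (vec d) := by
  intro hcr
  have hpos : ∀ a b, a ≠ b → 0 < lam (vec a) (vec b) := fun a b hab =>
    Real.sqrt_pos.2 (lt_of_le_of_ne (neg_nonneg.2 (minkowski_nonpos (hcone a) (hcone b)))
      (neg_ne_zero.2 (hne a b hab)).symm)
  have hP := lam_ptolemy_eq (hcone a) (hcone b) (hcone c) (hcone d) hcr
  have n1 := left_ne_zero_of_mul hcr.ne
  have n2 := right_ne_zero_of_mul hcr.ne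
  have hab : a ≠ b := by rintro rfl; apply n1; simp only [orient]; ring
  have hbc : b ≠ c := by rintro rfl; apply n1; simp only [orient]; ring
  have hcd : c ≠ d := by rintro rfl; apply n2; simp only [orient]; ring
  have had : a ≠ d := by rintro rfl; apply n2; simp only [orient]; ring
  rcases le_total (lam (vec a) (vec c)) (lam (vec b) (vec d)) with h | h
  · exact spanningGraph_noncrossing_aux _ hl hpos hab hbc hcd had hP h h1 h2
  · refine spanningGraph_noncrossing_aux _ hl hpos hbc hcd had.symm hab.symm ?_ ?_ h2 h1.symm
    · rw [hl c a, hl d a, hl b a]; linarith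
    · rw [hl c a]; exact h

theorem shorterGraph_reachable_mul_left {π : Type*} [Group π] {l : π → π → ℝ}
    (hl : ∀ a b, l a b = l b a) (hinv : ∀ g a b, l (g * a) (g * b) = l a b) {w : ℝ} (g : π) {a b : π}
    (h : (shorterGraph l hl w).Reachable a b) :
    (shorterGraph l hl w).Reachable (g * a) (g * b) := by
  let φ : shorterGraph l hl w →g shorterGraph l hl w :=
    ⟨fun x => g * x, fun {x y} h => ⟨fun e => h.1 (mul_left_cancel e), by rw [hinv]; exact h.2⟩⟩
  exact h.map φ

theorem spanningGraph_adj_mul_left {π : Type*} [Group π] {l : π → π → ℝ}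
    (hl : ∀ a b, l a b = l b a) (hinv : ∀ g a b, l (g * a) (g * b) = l a b) {L : ℝ} (g a b : π)
    (h : (spanningGraph l hl L).Adj a b) : (spanningGraph l hl L).Adj (g * a) (g * b) := by
  refine ⟨fun e => h.1 (mul_left_cancel e), (hinv g a b).symm ▸ h.2.1, fun hr => h.2.2 ?_⟩
  rw [hinv] at hr
  simpa using shorterGraph_reachable_mul_left hl hinv g⁻¹ hr

theorem connected_of_generators {π : Type*} [Group π] (G : SimpleGraph π)
    (hG : ∀ g a b, G.Adj a b → G.Adj (g * a) (g * b)) (S : Set π) (hS : Subgroup.closure S = ⊤)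
    (hSG : ∀ s ∈ S, G.Reachable 1 s) : G.Connected := by
  have hmul : ∀ g a b, G.Reachable a b → G.Reachable (g * a) (g * b) := fun g a b h =>
    h.map (G' := G) ⟨fun x => g * x, fun h => hG g _ _ h⟩
  have hone : ∀ g : π, G.Reachable 1 g := by
    intro g
    have hg : g ∈ Subgroup.closure S := hS ▸ Subgroup.mem_top g
    induction hg using Subgroup.closure_induction with
    | mem s hs => exact hSG s hs
    | one => exact SimpleGraph.Reachable.refl _
    | mul x y _ _ hx hy =>
      have := hmul x 1 y hy
      rw [mul_one] at this
      exact hx.trans this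
    | inv x _ hx =>
      have := hmul x⁻¹ 1 x hx
      rw [mul_one, inv_mul_cancel] at this
      exact this.symm
  exact ⟨fun a b => (hone a).symm.trans (hone b)⟩

theorem exists_shortest_path {V : Type*} {G : SimpleGraph V} (hG : G.Connected) (c d : V) :
    ∃ (n : ℕ) (p : ℕ → V), p 0 = c ∧ p n = d ∧ (∀ k < n, G.Adj (p k) (p (k + 1))) ∧
      ∀ k l, k ≤ l → l ≤ n → (p k = p l → k = l) ∧ (G.Adj (p k) (p l) → l = k + 1) := by
  obtain ⟨w, hw⟩ := hG.exists_walk_length_eq_dist c d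
  refine ⟨w.length, w.getVert, w.getVert_zero, w.getVert_length,
    fun k hk => w.adj_getVert_succ hk, fun k l hkl hl => ?_⟩
  have hdist : ∀ a m, a + m ≤ w.length → G.dist (w.getVert a) (w.getVert (a + m)) ≤ m := by
    intro a m
    induction m with
    | zero => intro _; simp
    | succ m ih =>
      intro h
      have h1 := hG.dist_triangle (u := w.getVert a) (v := w.getVert (a + m))
        (w := w.getVert (a + (m + 1)))
      have h2 : G.dist (w.getVert (a + m)) (w.getVert (a + m + 1)) = 1 :=
        SimpleGraph.dist_eq_one_iff_adj.2 (w.adj_getVert_succ (by omega))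
      rw [← add_assoc] at h1 ⊢
      have := ih (by omega)
      omega
  have h1 := hdist 0 k (by omega)
  have h2 := hdist l (w.length - l) (by omega)
  rw [w.getVert_zero, zero_add] at h1
  rw [Nat.add_sub_cancel' hl, w.getVert_length] at h2
  have h3 := hG.dist_triangle (u := c) (v := w.getVert k) (w := d)
  have h4 := hG.dist_triangle (u := w.getVert k) (v := w.getVert l) (w := d)
  constructor
  · intro e
    rw [e] at h3 h1
    omega
  · intro e
    have h5 : G.dist (w.getVert k) (w.getVert l) = 1 := SimpleGraph.dist_eq_one_iff_adj.2 e
    have h6 : k ≠ l := fun h => G.loopless.irrefl _ (h ▸ e)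
    omega

namespace DecoratedMetric

variable {π ι : Type*} [Group π] [Fintype ι] (m : DecoratedMetric π ι)

/-- There is a connected, locally finite, invariant graph on the orbit of a spike whose edges are
pairwise non-crossing geodesics. -/
theorem exists_noncrossing_graph [Group.FG π] (i : ι) : ∃ (G : SimpleGraph π) (F : Finset π),
    G.Connected ∧ (∀ g a b, G.Adj a b → G.Adj (g * a) (g * b)) ∧ (∀ a b, G.Adj a b → a⁻¹ * b ∈ F) ∧
    ∀ a b x y, G.Adj a b → G.Adj x y →
      ¬ Crosses (m.lift (a, i)) (m.lift (b, i)) (m.lift (x, i)) (m.lift (y, i)) := by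
  classical
  obtain ⟨S, hS⟩ := Group.FG.out (G := π)
  set l : π → π → ℝ := fun a b => lam (m.lift (a, i)) (m.lift (b, i)) with hldef
  have hl : ∀ a b, l a b = l b a := fun a b => lam_comm _ _
  have hl0 : ∀ a b, 0 ≤ l a b := fun a b => lam_nonneg _ _
  have hinv : ∀ g a b, l (g * a) (g * b) = l a b := fun g a b =>
    congrArg (fun y => √(-y)) (m.minkowski_lift_mul g (a, i) (b, i))
  obtain ⟨k, hk, hlow⟩ := m.exists_orbit_lower i
  -- Large enough for the edges from `1` to the generators, which gives connectedness; discreteness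
  -- leaves finitely many edge types of length at most `L`.
  obtain ⟨L, hL⟩ := ((S : Set π).toFinite.image (l 1)).bddAbove
  have hfinE : {γ : π | l 1 γ ≤ L}.Finite := by
    refine ((Set.finite_singleton (1 : π)).union (m.finite_coshDisp_le (L ^ 2 / k))).subset ?_
    intro γ hγ
    by_cases h1 : γ = 1
    · exact Or.inl h1
    · right
      have h2 := hlow γ h1
      have h3 := m.lam_lift_sq i 1 γ
      rw [inv_one, one_mul] at h3
      rw [← h3] at h2
      have h4 : l 1 γ ^ 2 ≤ L ^ 2 := pow_le_pow_left₀ (hl0 _ _) hγ 2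
      change m.coshDisp γ ≤ L ^ 2 / k
      rw [le_div_iff₀ hk]
      simp only [hldef] at h4
      linarith
  have hl1 : ∀ a b, l a b = l 1 (a⁻¹ * b) := fun a b => by
    rw [← hinv a⁻¹ a b, inv_mul_cancel]
  have hadj := spanningGraph_adj_mul_left hl hinv (L := L)
  refine ⟨spanningGraph l hl L, hfinE.toFinset, ?_, hadj, ?_, ?_⟩
  · refine connected_of_generators _ hadj S hS fun s hs => spanningGraph_reachable l hl ?_
      (hL (Set.mem_image_of_mem _ hs))
    refine (hfinE.image (l 1)).subset ?_
    rintro x ⟨hx, a, b, rfl⟩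
    rw [hl1] at hx ⊢
    exact Set.mem_image_of_mem _ hx
  · intro a b hab
    rw [Set.Finite.mem_toFinset, Set.mem_ofPred_eq, ← hl1]
    exact hab.2.1
  · intro a b x y hab hxy
    exact spanningGraph_noncrossing (vec := fun γ => m.lift (γ, i)) (fun γ => m.lift_mem _)
      (fun γ δ h => m.minkowski_lift_lift_ne_zero h i) hl hab hxy

end DecoratedMetric

/-! ### Convex cocompactness -/

theorem exists_last_before {P : ℕ → Prop} {k : ℕ} (h0 : P 0) (hk : ¬ P k) :
    ∃ i < k, P i ∧ ∀ l, i < l → l ≤ k → ¬ P l := by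
  induction k with
  | zero => exact absurd h0 hk
  | succ k ih =>
    by_cases h : P k
    · refine ⟨k, k.lt_succ_self, h, fun l h1 h2 => ?_⟩
      obtain rfl : l = k + 1 := by omega
      exact hk
    · obtain ⟨i, hi, hPi, hl⟩ := ih h
      refine ⟨i, by omega, hPi, fun l h1 h2 => ?_⟩
      rcases Nat.lt_or_ge k l with h3 | h3
      · obtain rfl : l = k + 1 := by omega
        exact hk
      · exact hl l h1 h3

theorem exists_first_after {P : ℕ → Prop} {k n : ℕ} (hkn : k ≤ n) (hn : P n) (hk : ¬ P k) :
    ∃ j, k < j ∧ j ≤ n ∧ P j ∧ ∀ l, k ≤ l → l < j → ¬ P l := by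
  obtain ⟨i, h1, h2, h3⟩ := exists_last_before (P := fun i => P (n - i)) (k := n - k)
    (by simpa using hn) (by rwa [Nat.sub_sub_self hkn])
  refine ⟨n - i, by omega, by omega, h2, fun l h4 h5 => ?_⟩
  have := h3 (n - l) (by omega) (by omega)
  rwa [Nat.sub_sub_self (by omega)] at this

/-- A point close to a geodesic `ab` whose endpoints are close to a geodesic `cd` is close to `cd`. -/
theorem quasigeodesic_trans {Aca Aad Acb Abd Aay Ayb Aab Acy Ayd D C₁ C₂ C₄ : ℝ}
    (hca : 1 ≤ Aca) (hcb : 1 ≤ Acb) (hay : 1 ≤ Aay) (hyb : 1 ≤ Ayb)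
    (hab : 1 ≤ Aab) (hcy : 1 ≤ Acy) (hyd : 1 ≤ Ayd) (hD : 1 ≤ D) (hC₁ : 0 ≤ C₁) (hC₂ : 0 ≤ C₂)
    (h1 : Aca * Aad ≤ C₁ * D) (h2 : Acb * Abd ≤ C₁ * D) (h3 : Aay * Ayb ≤ C₂ * Aab)
    (t1 : Abd ≤ 3 * (Aad * Aab)) (t2 : Aad ≤ 3 * (Aab * Abd))
    (f1 : Acy * Aab ≤ C₄ * (Aca * Ayb + Acb * Aay))
    (f2 : Ayd * Aab ≤ C₄ * (Aad * Ayb + Abd * Aay)) :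
    Acy * Ayd ≤ C₄ ^ 2 * (2 * C₁ * C₂ ^ 2 + 6 * C₁ * C₂) * D := by
  have e1 : Ayb ≤ C₂ * Aab := le_trans (by nlinarith) h3
  have e2 : Aay ≤ C₂ * Aab := le_trans (by nlinarith) h3
  have hCD : 0 ≤ C₁ * D := by positivity
  have hCA : 0 ≤ C₂ * Aab := by positivity
  -- Multiplying `f1` by `f2` gives four products; each is bounded by a multiple of `D * Aab ^ 2`,
  -- and `Aab ^ 2` cancels.
  have s1 : (Aca * Aad) * (Ayb * Ayb) ≤ (C₁ * D) * ((C₂ * Aab) * (C₂ * Aab)) := by gcongr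
  have s4 : (Acb * Abd) * (Aay * Aay) ≤ (C₁ * D) * ((C₂ * Aab) * (C₂ * Aab)) := by gcongr
  have s2 : (Aca * Abd) * (Aay * Ayb) ≤ (3 * (C₁ * D) * Aab) * (C₂ * Aab) := by
    refine mul_le_mul ?_ h3 (by positivity) (by positivity)
    calc Aca * Abd ≤ Aca * (3 * (Aad * Aab)) := by gcongr
      _ = 3 * (Aca * Aad) * Aab := by ring
      _ ≤ _ := by gcongr
  have s3 : (Acb * Aad) * (Aay * Ayb) ≤ (3 * (C₁ * D) * Aab) * (C₂ * Aab) := by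
    refine mul_le_mul ?_ h3 (by positivity) (by positivity)
    calc Acb * Aad ≤ Acb * (3 * (Aab * Abd)) := by gcongr
      _ = 3 * (Acb * Abd) * Aab := by ring
      _ ≤ _ := by gcongr
  have hp := mul_le_mul f1 f2 (by positivity) (le_trans (by positivity) f1)
  have hsum : (Aca * Ayb + Acb * Aay) * (Aad * Ayb + Abd * Aay) ≤
      (2 * C₁ * C₂ ^ 2 + 6 * C₁ * C₂) * D * Aab ^ 2 := by nlinarith
  have hfin : (Acy * Ayd) * Aab ^ 2 ≤ (C₄ ^ 2 * (2 * C₁ * C₂ ^ 2 + 6 * C₁ * C₂) * D) * Aab ^ 2 := by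
    calc (Acy * Ayd) * Aab ^ 2 = (Acy * Aab) * (Ayd * Aab) := by ring
      _ ≤ _ := hp
      _ = C₄ ^ 2 * ((Aca * Ayb + Acb * Aay) * (Aad * Ayb + Abd * Aay)) := by ring
      _ ≤ C₄ ^ 2 * ((2 * C₁ * C₂ ^ 2 + 6 * C₁ * C₂) * D * Aab ^ 2) :=
        mul_le_mul_of_nonneg_left hsum (sq_nonneg _)
      _ = _ := by ring
  exact le_of_mul_le_mul_right hfin (by positivity)

namespace DecoratedMetric

variable {π ι : Type*} [Group π] [Fintype ι] (m : DecoratedMetric π ι)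

theorem coshDisp_inv_mul_comm (a b : π) : m.coshDisp (a⁻¹ * b) = m.coshDisp (b⁻¹ * a) := by
  rw [← coshDisp_inv, _root_.mul_inv_rev, inv_inv]

theorem coshDisp_triangle (a b c : π) : m.coshDisp (a⁻¹ * c) ≤
    3 * (m.coshDisp (a⁻¹ * b) * m.coshDisp (b⁻¹ * c)) := by
  have h := m.coshDisp_mul_le (a⁻¹ * b) (b⁻¹ * c)
  rwa [mul_assoc, mul_inv_cancel_left] at h

/-- The endpoints of a short edge that crosses the geodesic `cd` are close to `cd`. -/
theorem exists_crossing_bound (i : ι) (F : Finset π) : ∃ C : ℝ, 0 < C ∧ ∀ c d y w : π,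
    y⁻¹ * w ∈ F →
    Crosses (m.lift (c, i)) (m.lift (d, i)) (m.lift (y, i)) (m.lift (w, i)) →
    m.coshDisp (c⁻¹ * y) * m.coshDisp (y⁻¹ * d) ≤ C * m.coshDisp (c⁻¹ * d) := by
  obtain ⟨k, hk, hlow⟩ := m.exists_orbit_lower i
  obtain ⟨K, hK, hup⟩ := m.minkowski_lift_upper i i
  obtain ⟨B, hB⟩ := (F.finite_toSet.image m.coshDisp).bddAbove
  set B' := max B 1
  have hB' : 0 < B' := lt_of_lt_of_le one_pos (le_max_right _ _)
  refine ⟨3 * B' * (K ^ 2 * B' / k ^ 2), by positivity, fun c d y w hyw hcr => ?_⟩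
  have hA : ∀ γ, 0 < m.coshDisp γ := m.coshDisp_pos
  have hywB : m.coshDisp (y⁻¹ * w) ≤ B' := (hB (Set.mem_image_of_mem _ hyw)).trans (le_max_left _ _)
  have hP := lam_ptolemy_eq (m.lift_mem (c, i)) (m.lift_mem (y, i)) (m.lift_mem (d, i))
    (m.lift_mem (w, i)) hcr
  have n1 := left_ne_zero_of_mul hcr.ne
  have n2 := right_ne_zero_of_mul hcr.ne
  have hcy : c ≠ y := by rintro rfl; apply n1; simp only [orient]; ring
  have hdw : d ≠ w := by rintro rfl; apply n2; simp only [orient]; ring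
  have l1 : k * m.coshDisp (c⁻¹ * y) ≤ lam (m.lift (c, i)) (m.lift (y, i)) ^ 2 := by
    rw [lam_lift_sq]; exact hlow _ fun e => hcy (inv_mul_eq_one.1 e)
  have l2 : k * m.coshDisp (d⁻¹ * w) ≤ lam (m.lift (d, i)) (m.lift (w, i)) ^ 2 := by
    rw [lam_lift_sq]; exact hlow _ fun e => hdw (inv_mul_eq_one.1 e)
  have u : ∀ x z, lam (m.lift (x, i)) (m.lift (z, i)) ^ 2 ≤ K * m.coshDisp (x⁻¹ * z) :=
    fun x z => by rw [lam_lift_sq]; exact hup _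
  have q1 := mul_le_mul l1 l2 (mul_pos hk (hA _)).le (sq_nonneg _)
  have q2 := mul_le_mul (u c d) ((u y w).trans (mul_le_mul_of_nonneg_left hywB hK.le))
    (sq_nonneg _) (mul_pos hK (hA _)).le
  -- One summand of Ptolemy's equality is dropped. As `yw` is short, `w` may then be replaced by `y`
  -- at bounded cost.
  have hPle : lam (m.lift (c, i)) (m.lift (y, i)) * lam (m.lift (d, i)) (m.lift (w, i)) ≤
      lam (m.lift (c, i)) (m.lift (d, i)) * lam (m.lift (y, i)) (m.lift (w, i)) := by
    have := mul_nonneg (lam_nonneg (m.lift (y, i)) (m.lift (d, i)))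
      (lam_nonneg (m.lift (c, i)) (m.lift (w, i)))
    linarith
  have hP2 := pow_le_pow_left₀ (mul_nonneg (lam_nonneg _ _) (lam_nonneg _ _)) hPle 2
  simp only [mul_pow] at hP2
  have h5 : m.coshDisp (c⁻¹ * y) * m.coshDisp (d⁻¹ * w) ≤
      K ^ 2 * B' / k ^ 2 * m.coshDisp (c⁻¹ * d) := by
    rw [div_mul_eq_mul_div, le_div_iff₀ (by positivity)]
    linarith
  have h6 := m.coshDisp_triangle y w d
  rw [m.coshDisp_inv_mul_comm w d] at h6
  have h7 : m.coshDisp (y⁻¹ * d) ≤ 3 * (B' * m.coshDisp (d⁻¹ * w)) := by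
    refine h6.trans ?_
    have := (hA (d⁻¹ * w)).le
    gcongr
  calc m.coshDisp (c⁻¹ * y) * m.coshDisp (y⁻¹ * d)
      ≤ m.coshDisp (c⁻¹ * y) * (3 * (B' * m.coshDisp (d⁻¹ * w))) :=
        mul_le_mul_of_nonneg_left h7 (hA _).le
    _ = 3 * B' * (m.coshDisp (c⁻¹ * y) * m.coshDisp (d⁻¹ * w)) := by ring
    _ ≤ 3 * B' * (K ^ 2 * B' / k ^ 2 * m.coshDisp (c⁻¹ * d)) := by gcongr
    _ = _ := by ring

/-- The number of group elements close to a geodesic is bounded linearly in its length. -/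
theorem exists_count_bound (C : ℝ) (hC : 1 ≤ C) : ∃ M : ℝ, 0 < M ∧ ∀ (γ : π) (p : ℕ → π) (n : ℕ),
    (∀ k l, k < l → l ≤ n → p k ≠ p l) →
    (∀ k ≤ n, m.coshDisp (p k) * m.coshDisp ((p k)⁻¹ * γ) ≤ C * m.coshDisp γ) →
    (n : ℝ) ≤ M * (1 + Real.log (m.coshDisp γ)) := by
  classical
  obtain ⟨C₄, hC₄, hfour⟩ := m.exists_four_point
  set R := C₄ * (2 * Real.exp 1 * C) with hR
  have hfin := m.finite_coshDisp_le R
  set N := hfin.toFinset.card with hN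
  have hlogC : 0 ≤ Real.log C := Real.log_nonneg hC
  refine ⟨N * (Real.log C + 1) + 1, by positivity, fun γ p n hinj hgood => ?_⟩
  have hA : ∀ γ, 0 < m.coshDisp γ := m.coshDisp_pos
  have hA1 : ∀ γ, 1 ≤ m.coshDisp γ := m.one_le_coshDisp
  -- Sorts the points into annuli around the base point. The number of annuli is linear in `log
  -- (coshDisp γ)`.
  set f : ℕ → ℕ := fun k => ⌊Real.log (m.coshDisp (p k))⌋₊ with hf
  have hlog0 : ∀ γ, 0 ≤ Real.log (m.coshDisp γ) := fun γ => Real.log_nonneg (hA1 γ)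
  have hcomp : ∀ k l, f k = f l → m.coshDisp (p k) ≤ Real.exp 1 * m.coshDisp (p l) := by
    intro k l h
    have h1 := Nat.lt_floor_add_one (Real.log (m.coshDisp (p k)))
    have h2 := Nat.floor_le (hlog0 (p l))
    have h3 : (⌊Real.log (m.coshDisp (p k))⌋₊ : ℝ) = ⌊Real.log (m.coshDisp (p l))⌋₊ :=
      congrArg Nat.cast h
    have h4 : Real.log (m.coshDisp (p k)) ≤ 1 + Real.log (m.coshDisp (p l)) := by linarith
    rw [← Real.exp_log (hA (p k)), ← Real.exp_log (hA (p l)), ← Real.exp_add, Real.exp_le_exp]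
    exact h4
  -- By the four-point inequality, two points near the geodesic in the same annulus are at bounded
  -- distance, so discreteness bounds the number of points in each annulus.
  have hclose : ∀ k l, k ≤ n → l ≤ n → f k = f l → m.coshDisp ((p k)⁻¹ * p l) ≤ R := by
    intro k l hk hl h
    have h1 := hfour (p k) (p l) 1 γ
    rw [inv_one, one_mul, one_mul, one_mul, m.coshDisp_inv_mul_comm γ (p l)] at h1
    have h2 : m.coshDisp (p k) * m.coshDisp ((p l)⁻¹ * γ) ≤ Real.exp 1 * (C * m.coshDisp γ) := by
      calc _ ≤ (Real.exp 1 * m.coshDisp (p l)) * m.coshDisp ((p l)⁻¹ * γ) :=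
            mul_le_mul_of_nonneg_right (hcomp k l h) (hA _).le
        _ = Real.exp 1 * (m.coshDisp (p l) * m.coshDisp ((p l)⁻¹ * γ)) := by ring
        _ ≤ _ := mul_le_mul_of_nonneg_left (hgood l hl) (Real.exp_pos 1).le
    have h3 : m.coshDisp (p l) * m.coshDisp ((p k)⁻¹ * γ) ≤ Real.exp 1 * (C * m.coshDisp γ) := by
      calc _ ≤ (Real.exp 1 * m.coshDisp (p k)) * m.coshDisp ((p k)⁻¹ * γ) :=
            mul_le_mul_of_nonneg_right (hcomp l k h.symm) (hA _).le
        _ = Real.exp 1 * (m.coshDisp (p k) * m.coshDisp ((p k)⁻¹ * γ)) := by ring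
        _ ≤ _ := mul_le_mul_of_nonneg_left (hgood k hk) (Real.exp_pos 1).le
    have h4 : m.coshDisp γ * m.coshDisp ((p k)⁻¹ * p l) ≤ m.coshDisp γ * R := by
      refine h1.trans ((mul_le_mul_of_nonneg_left (add_le_add h2 h3) hC₄.le).trans (le_of_eq ?_))
      rw [hR]; ring
    exact le_of_mul_le_mul_left h4 (hA γ)
  have hcard : (Finset.range (n + 1)).card ≤ N * ((Finset.range (n + 1)).image f).card := by
    refine Finset.card_le_mul_card_image _ _ fun a ha => ?_
    obtain ⟨k, hk, rfl⟩ := Finset.mem_image.1 ha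
    rw [Finset.mem_range] at hk
    refine Finset.card_le_card_of_injOn (fun l => (p k)⁻¹ * p l) (fun l hl => ?_) ?_
    · have hl' := Finset.mem_filter.1 hl
      rw [Finset.mem_range] at hl'
      rw [Finset.mem_coe, Set.Finite.mem_toFinset]
      exact hclose k l (by omega) (by omega) hl'.2.symm
    · intro a ha b hb hab
      have ha' := (Finset.mem_range.1 (Finset.mem_filter.1 ha).1)
      have hb' := (Finset.mem_range.1 (Finset.mem_filter.1 hb).1)
      have hpab : p a = p b := mul_left_cancel hab
      rcases lt_trichotomy a b with h | h | h
      · exact absurd hpab (hinj a b h (by omega))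
      · exact h
      · exact absurd hpab.symm (hinj b a h (by omega))
  have himage : ((Finset.range (n + 1)).image f).card ≤ ⌊Real.log (C * m.coshDisp γ)⌋₊ + 1 := by
    rw [← Finset.card_range (⌊Real.log (C * m.coshDisp γ)⌋₊ + 1)]
    refine Finset.card_le_card fun a ha => ?_
    obtain ⟨k, hk, rfl⟩ := Finset.mem_image.1 ha
    rw [Finset.mem_range] at hk ⊢
    refine Nat.lt_succ_of_le (Nat.floor_le_floor (Real.log_le_log (hA _) ?_))
    have h1 := hgood k (by omega)
    have h2 := le_mul_of_one_le_right (hA (p k)).le (hA1 ((p k)⁻¹ * γ))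
    exact h2.trans h1
  rw [Finset.card_range] at hcard
  have h1 : ((n + 1 : ℕ) : ℝ) ≤ N * ((⌊Real.log (C * m.coshDisp γ)⌋₊ + 1 : ℕ) : ℝ) := by
    exact_mod_cast hcard.trans (Nat.mul_le_mul_left _ himage)
  have h2 : (⌊Real.log (C * m.coshDisp γ)⌋₊ : ℝ) ≤ Real.log C + Real.log (m.coshDisp γ) := by
    rw [← Real.log_mul (by linarith) (hA γ).ne']
    exact Nat.floor_le (Real.log_nonneg (one_le_mul_of_one_le_of_one_le hC (hA1 γ)))
  push_cast at h1
  have h3 := hlog0 γ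
  have hN0 : (0 : ℝ) ≤ N := Nat.cast_nonneg _
  have h4 := mul_le_mul_of_nonneg_left (add_le_add_left h2 1) hN0
  have h5 := mul_nonneg hN0 (mul_nonneg hlogC h3)
  nlinarith

/-- Convex cocompactness of the holonomy: each element is the product of a chain of
generators that follows a geodesic of the hyperbolic plane. -/
theorem exists_chain [Group.FG π] : ∃ (C : ℝ) (F : Finset π), 0 < C ∧ ∀ γ : π,
    ∃ (n : ℕ) (p : ℕ → π), p 0 = 1 ∧ p n = γ ∧ (∀ k < n, (p k)⁻¹ * p (k + 1) ∈ F) ∧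
      (∀ k ≤ n, m.coshDisp (p k) * m.coshDisp ((p k)⁻¹ * γ) ≤ C * m.coshDisp γ) ∧
      (n : ℝ) ≤ C * (1 + Real.log (m.coshDisp γ)) := by
  classical
  obtain ⟨i⟩ := m.nonempty_spikes
  obtain ⟨G, F, hconn, hGinv, hGF, hnc⟩ := m.exists_noncrossing_graph i
  have hA : ∀ γ, 0 < m.coshDisp γ := m.coshDisp_pos
  have hA1 : ∀ γ, 1 ≤ m.coshDisp γ := m.one_le_coshDisp
  have hcone : ∀ γ, m.lift (γ, i) ∈ positiveLightCone := fun γ => m.lift_mem _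
  have hne : ∀ a b, a ≠ b → minkowski (m.lift (a, i)) (m.lift (b, i)) ≠ 0 := fun a b h =>
    m.minkowski_lift_lift_ne_zero h i
  have hD : ∀ g a b c, orient (m.lift (g * a, i)) (m.lift (g * b, i)) (m.lift (g * c, i)) =
      (m.holMatrix g).det * orient (m.lift (a, i)) (m.lift (b, i)) (m.lift (c, i)) := by
    intro g a b c
    rw [lift_mul, lift_mul, lift_mul, orient_mulVec]
  obtain ⟨N, hN⟩ := periodic_of_turns G hcone hne hD hGinv F hGF
  obtain ⟨C₂, hC₂⟩ := exists_quasigeodesic_bound hA1 m.coshDisp_inv (by norm_num : (1 : ℝ) ≤ 3)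
    m.coshDisp_mul_le m.exists_cyclic_bound F N
  obtain ⟨C₁, hC₁, hcross⟩ := m.exists_crossing_bound i F
  obtain ⟨C₄, hC₄, hfour⟩ := m.exists_four_point
  set C₁' := max C₁ 1 with hC₁'
  set C₂' := max C₂ 0 with hC₂'
  set C₃ := max (C₄ ^ 2 * (2 * C₁' * C₂' ^ 2 + 6 * C₁' * C₂')) C₁' with hC₃
  have hC₁1 : 1 ≤ C₁' := le_max_right _ _
  have hC₃1 : 1 ≤ C₃ := hC₁1.trans (le_max_right _ _)
  obtain ⟨M, hM, hcount⟩ := m.exists_count_bound C₃ hC₃1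
  refine ⟨max C₃ M, F, lt_of_lt_of_le hM (le_max_right _ _), fun γ => ?_⟩
  by_cases hγ : (1 : π) = γ
  · subst hγ
    refine ⟨0, fun _ => 1, rfl, rfl, fun k hk => absurd hk (Nat.not_lt_zero k), fun k _ => ?_, ?_⟩
    · rw [inv_one, one_mul]
      simp only [coshDisp_one]
      have := le_max_left C₃ M
      linarith
    · simp only [coshDisp_one, Real.log_one, Nat.cast_zero, add_zero, mul_one]
      exact hM.le.trans (le_max_right _ _)
  obtain ⟨n, p, hp0, hpn, hadj, hsh⟩ := exists_shortest_path hconn 1 γ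
  have hinj : ∀ k l, k < l → l ≤ n → p k ≠ p l := fun k l h1 h2 e =>
    h1.ne ((hsh k l h1.le h2).1 e)
  set Good : ℕ → Prop := fun k => p k = 1 ∨ p k = γ ∨ ∃ w, G.Adj (p k) w ∧
    Crosses (m.lift (1, i)) (m.lift (γ, i)) (m.lift (p k, i)) (m.lift (w, i)) with hGood
  have hGoodA : ∀ k, Good k →
      m.coshDisp (p k) * m.coshDisp ((p k)⁻¹ * γ) ≤ C₁' * m.coshDisp γ := by
    rintro k (h | h | ⟨w, hw, hcr⟩)
    · rw [h, inv_one, one_mul, coshDisp_one]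
      nlinarith [hA γ]
    · rw [h, inv_mul_cancel, coshDisp_one]
      nlinarith [hA γ]
    · have h1 := hcross 1 γ (p k) w (hGF _ _ hw) hcr
      rw [inv_one, one_mul, one_mul] at h1
      exact h1.trans (mul_le_mul_of_nonneg_right (le_max_left _ _) (hA γ).le)
  have hgood : ∀ k ≤ n, m.coshDisp (p k) * m.coshDisp ((p k)⁻¹ * γ) ≤ C₃ * m.coshDisp γ := by
    intro k hkn
    by_cases hk : Good k
    · exact (hGoodA k hk).trans (mul_le_mul_of_nonneg_right (le_max_right _ _) (hA γ).le)
    -- The maximal run of bad vertices around `k`, between two good ones. Inside it the path turns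
    -- consistently, so `p k` is close to the geodesic from `p a` to `p b`, whose ends are close to
    -- the one from `1` to `γ`.
    obtain ⟨a, hak, hGa, ha⟩ := exists_last_before (P := Good) (Or.inl hp0) hk
    obtain ⟨b, hkb, hbn, hGb, hb⟩ := exists_first_after (P := Good) hkn (Or.inr (Or.inl hpn)) hk
    have hbad : ∀ l, a < l → l < b → ¬ Good l := fun l h1 h2 => by
      rcases le_total l k with h | h
      · exact ha l h1 h
      · exact hb l h h2
    obtain ⟨e, he⟩ := turns_of_noncrossing G hcone hne hnc hγ (p := p) (i := a) (j := b)
      (fun l _ h2 => hadj l (by omega)) (fun l l' _ h2 h3 => hsh l l' h2 (by omega))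
      (by rintro y (rfl | rfl); exacts [hGa, hGb])
      (by
        intro l h1 h2
        have h3 := hbad l h1 h2
        simp only [hGood] at h3
        push Not at h3
        exact h3)
    have hper := hN (fun s => p (a + s)) (b - a) e
      (fun s hs => hadj (a + s) (by omega)) (fun s hs => he (a + s) (by omega) (by omega))
    have hq := hC₂ (fun s => p (a + s)) (b - a) (fun s hs => hGF _ _ (hadj (a + s) (by omega)))
      (fun s s' h1 h2 => hinj _ _ (by omega) (by omega)) hper (k - a) (by omega)
    simp only [add_zero] at hq
    rw [Nat.add_sub_cancel' hak.le, Nat.add_sub_cancel' (hak.trans hkb).le] at hq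
    have f1 := hfour (p a) (p b) 1 (p k)
    have f2 := hfour (p a) (p b) γ (p k)
    rw [inv_one, one_mul, one_mul, one_mul] at f1
    rw [m.coshDisp_inv_mul_comm γ (p k), m.coshDisp_inv_mul_comm γ (p a),
      m.coshDisp_inv_mul_comm γ (p b)] at f2
    have t1 := m.coshDisp_triangle (p b) (p a) γ
    rw [m.coshDisp_inv_mul_comm (p b) (p a), mul_comm (m.coshDisp ((p a)⁻¹ * p b))] at t1
    have t2 := m.coshDisp_triangle (p a) (p b) γ
    have hfin := quasigeodesic_trans (hA1 _) (hA1 _) (hA1 _) (hA1 _) (hA1 _) (hA1 _) (hA1 _)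
      (hA1 _) (zero_le_one.trans hC₁1) (le_max_right C₂ 0) (hGoodA a hGa) (hGoodA b hGb)
      (hq.trans (mul_le_mul_of_nonneg_right (le_max_left C₂ 0) (hA _).le)) t1 t2 f1 f2
    exact hfin.trans (mul_le_mul_of_nonneg_right (le_max_left _ _) (hA γ).le)
  refine ⟨n, p, hp0, hpn, fun k hk => hGF _ _ (hadj k hk), fun k hk => (hgood k hk).trans ?_, ?_⟩
  · exact mul_le_mul_of_nonneg_right (le_max_left _ _) (hA γ).le
  · refine (hcount γ p n hinj hgood).trans (mul_le_mul_of_nonneg_right (le_max_right _ _) ?_)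
    have := Real.log_nonneg (hA1 γ)
    linarith

end DecoratedMetric

/-! ### Growth of cocycles and derivatives of lengths -/

theorem minkowski_add_right (a b c : Fin 3 → ℝ) :
    minkowski a (b + c) = minkowski a b + minkowski a c := by
  simp only [minkowski, Pi.add_apply]; ring

theorem minkowski_add_left (a b c : Fin 3 → ℝ) :
    minkowski (a + b) c = minkowski a c + minkowski b c := by
  simp only [minkowski, Pi.add_apply]; ring

theorem minkowski_sum {X : Type*} (s : Finset X) (v : Fin 3 → ℝ) (w : X → Fin 3 → ℝ) :
    minkowski v (∑ k ∈ s, w k) = ∑ k ∈ s, minkowski v (w k) := by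
  simp only [minkowski, Finset.sum_apply, Finset.mul_sum, Finset.sum_add_distrib,
    Finset.sum_sub_distrib]

theorem exists_mulVec_bound {π : Type*} (F : Finset π) (u : π → Matrix (Fin 3) (Fin 3) ℝ) :
    ∃ U : ℝ, 0 ≤ U ∧ ∀ s ∈ F, ∀ x, ‖u s *ᵥ x‖ ≤ U * ‖x‖ := by
  refine ⟨∑ s ∈ F, ‖LinearMap.toContinuousLinearMap (u s).mulVecLin‖,
    Finset.sum_nonneg fun _ _ => norm_nonneg _, fun s hs x => ?_⟩
  refine ((LinearMap.toContinuousLinearMap (u s).mulVecLin).le_opNorm x).trans ?_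
  exact mul_le_mul_of_nonneg_right (Finset.single_le_sum
    (f := fun s => ‖LinearMap.toContinuousLinearMap (u s).mulVecLin‖)
    (fun _ _ => norm_nonneg _) hs) (norm_nonneg x)

/-- A pointwise bounded family of linear forms on a finite-dimensional space is bounded. -/
theorem exists_uniform_bound {E B : Type*} [AddCommGroup E] [Module ℝ E] [FiniteDimensional ℝ E]
    (N : Seminorm ℝ E) (hN : ∀ u, N u = 0 → u = 0) (φ : B → E →ₗ[ℝ] ℝ) (l : B → ℝ)
    (h : ∀ u, ∃ C, ∀ b, 0 < l b → |φ b u| ≤ C * l b) :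
    ∃ K : ℝ, 0 < K ∧ ∀ u b, 0 < l b → |φ b u| ≤ K * l b * N u := by
  let _ : Norm E := ⟨N⟩
  have core : NormedSpace.Core ℝ E :=
    { norm_nonneg := fun x => apply_nonneg N x
      norm_smul := fun c x => map_smul_eq_mul N c x
      norm_triangle := fun x y => map_add_le_add N x y
      norm_eq_zero_iff := fun x => ⟨hN x, fun e => by rw [e]; exact map_zero N⟩ }
  let _ : NormedAddCommGroup E := NormedAddCommGroup.ofCore core
  let _ : NormedSpace ℝ E := NormedSpace.ofCore core
  set b := Module.finBasis ℝ E
  choose C hC using fun i => h (b i)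
  set c : Fin (Module.finrank ℝ E) → ℝ := fun i => ‖LinearMap.toContinuousLinearMap (b.coord i)‖
  have hc : ∀ i u, |b.repr u i| ≤ c i * N u := fun i u =>
    (LinearMap.toContinuousLinearMap (b.coord i)).le_opNorm u
  have hc0 : ∀ i, 0 ≤ c i := fun i => norm_nonneg _
  refine ⟨∑ i, c i * |C i| + 1, ?_, fun u β hβ => ?_⟩
  · have : 0 ≤ ∑ i, c i * |C i| := Finset.sum_nonneg fun i _ => mul_nonneg (hc0 i) (abs_nonneg _)
    linarith
  have hNu : 0 ≤ N u := apply_nonneg N u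
  calc |φ β u| = |∑ i, b.repr u i * φ β (b i)| := by
        conv_lhs => rw [← b.sum_repr u]
        simp only [map_sum, map_smul, smul_eq_mul]
    _ ≤ ∑ i, |b.repr u i * φ β (b i)| := Finset.abs_sum_le_sum_abs _ _
    _ ≤ ∑ i, (c i * N u) * (|C i| * l β) := by
        refine Finset.sum_le_sum fun i _ => ?_
        rw [abs_mul]
        refine mul_le_mul (hc i u) ?_ (abs_nonneg _) (mul_nonneg (hc0 i) hNu)
        exact (hC i β hβ).trans (mul_le_mul_of_nonneg_right (le_abs_self _) hβ.le)
    _ = (∑ i, c i * |C i|) * l β * N u := by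
        rw [Finset.sum_mul, Finset.sum_mul]
        exact Finset.sum_congr rfl fun i _ => by ring
    _ ≤ _ := by
        have := mul_nonneg hβ.le hNu
        nlinarith

/-- The finitely many exceptions are absorbed by enlarging the constant, as `l` is positive where
the estimate is claimed. -/
theorem exists_bound_of_eventually {X : Type*} {f l : X → ℝ} {C : ℝ}
    (h : ∀ᶠ x in cofinite, |f x| ≤ C * l x) : ∃ K, ∀ x, 0 < l x → |f x| ≤ K * l x := by
  have hE : {x | ¬ |f x| ≤ C * l x}.Finite := h
  obtain ⟨K, hK⟩ := (hE.image fun x => |f x| / l x).bddAbove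
  refine ⟨max C K, fun x hx => ?_⟩
  by_cases hxE : |f x| ≤ C * l x
  · exact hxE.trans (mul_le_mul_of_nonneg_right (le_max_left _ _) hx.le)
  · have h1 : |f x| / l x ≤ K := hK (Set.mem_image_of_mem (fun x => |f x| / l x) hxE)
    rw [div_le_iff₀ hx] at h1
    exact h1.trans (mul_le_mul_of_nonneg_right (le_max_right _ _) hx.le)

namespace DecoratedMetric

variable {π ι : Type*} [Group π] [Fintype ι] (m : DecoratedMetric π ι)

theorem cocycle_mul (z : m.cocycles) (γ δ : π) :
    z.1.1 (γ * δ) = z.1.1 γ + m.holMatrix γ * z.1.1 δ * m.holMatrix γ⁻¹ := z.2.2.1 γ δ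

theorem cocycle_one (z : m.cocycles) : z.1.1 1 = 0 := by
  have h := m.cocycle_mul z 1 1
  rw [inv_one, mul_one, holMatrix_one, Matrix.one_mul, Matrix.mul_one] at h
  exact left_eq_add.1 h

theorem cocycle_inv_eq_zero (z : m.cocycles) {γ : π} (h : z.1.1 γ = 0) : z.1.1 γ⁻¹ = 0 := by
  have h1 := m.cocycle_mul z γ⁻¹ γ
  rw [inv_mul_cancel, cocycle_one, h, Matrix.mul_zero, Matrix.zero_mul, add_zero] at h1
  exact h1.symm

/-- A cocycle is determined by its values on a finite generating set and by the velocities of the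
spikes. -/
theorem finiteDimensional_cocycles [Group.FG π] : FiniteDimensional ℝ m.cocycles := by
  obtain ⟨S, hS⟩ := Group.FG.out (G := π)
  let R : m.cocycles →ₗ[ℝ] ((S → Matrix (Fin 3) (Fin 3) ℝ) × (ι → Fin 3 → ℝ)) :=
    { toFun := fun z => (fun s => z.1.1 s, z.1.2)
      map_add' := fun _ _ => rfl
      map_smul' := fun _ _ => rfl }
  refine FiniteDimensional.of_injective R ((injective_iff_map_eq_zero R).2 fun z hz => ?_)
  have hz1 : ∀ s ∈ S, z.1.1 s = 0 := fun s hs => congrFun (Prod.ext_iff.1 hz).1 ⟨s, hs⟩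
  have hz2 : z.1.2 = 0 := (Prod.ext_iff.1 hz).2
  have hall : ∀ γ, z.1.1 γ = 0 := by
    intro γ
    have hγ : γ ∈ Subgroup.closure (S : Set π) := hS ▸ Subgroup.mem_top γ
    induction hγ using Subgroup.closure_induction with
    | mem s hs => exact hz1 s hs
    | one => exact m.cocycle_one z
    | mul x y _ _ hx hy =>
      rw [cocycle_mul, hx, hy, Matrix.mul_zero, Matrix.zero_mul, add_zero]
    | inv x _ hx => exact m.cocycle_inv_eq_zero z hx
  exact Subtype.ext (Prod.ext (funext hall) hz2)

theorem cocycle_telescope (z : m.cocycles) (p : ℕ → π) (hp : p 0 = 1) (n : ℕ) :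
    z.1.1 (p n) = ∑ k ∈ Finset.range n,
      m.holMatrix (p k) * z.1.1 ((p k)⁻¹ * p (k + 1)) * m.holMatrix (p k)⁻¹ := by
  induction n with
  | zero => rw [hp, cocycle_one, Finset.range_zero, Finset.sum_empty]
  | succ n ih =>
    rw [Finset.sum_range_succ, ← ih, ← cocycle_mul, mul_inv_cancel_left]

/-- The growth of a cocycle, relative to the pairing of two spikes. -/
theorem exists_cocycle_bound [Group.FG π] (z : m.cocycles) (i j : ι) : ∃ C : ℝ, 0 ≤ C ∧ ∀ γ : π,
    |minkowski (m.spike i) (z.1.1 γ *ᵥ m.lift (γ, j))| ≤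
      C * ((1 + Real.log (m.coshDisp γ)) * m.coshDisp γ) := by
  obtain ⟨C, F, hC, hchain⟩ := m.exists_chain
  obtain ⟨U, hU, hUF⟩ := exists_mulVec_bound F z.1.1
  have hA : ∀ γ, 0 < m.coshDisp γ := m.coshDisp_pos
  set B := 27 * (‖m.spike i‖ * (U * ‖m.spike j‖)) * C with hB
  have hB0 : 0 ≤ B := by positivity
  refine ⟨C * B, by positivity, fun γ => ?_⟩
  obtain ⟨n, p, hp0, hpn, hpF, hgood, hn⟩ := hchain γ
  have hterm : ∀ k ∈ Finset.range n, |minkowski (m.spike i)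
      ((m.holMatrix (p k) * z.1.1 ((p k)⁻¹ * p (k + 1)) * m.holMatrix (p k)⁻¹) *ᵥ m.lift (γ, j))| ≤
      B * m.coshDisp γ := by
    intro k hk
    rw [Finset.mem_range] at hk
    -- Moving `ρ(p k)` to the other argument splits the growth into `coshDisp (p k)` and `coshDisp
    -- ((p k)⁻¹ * γ)`, whose product the chain controls. The form and the two matrix bounds each
    -- contribute a factor `3`, hence the `27`.
    rw [← mulVec_mulVec, ← mulVec_mulVec, ← lift_mul, minkowski_comm, minkowski_holMatrix_inv]
    refine (abs_minkowski_le _ _).trans ?_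
    have h1 := m.norm_holMatrix_mulVec_le (p k)⁻¹ (m.spike i)
    rw [coshDisp_inv] at h1
    have h2 := m.norm_holMatrix_mulVec_le ((p k)⁻¹ * γ) (m.spike j)
    have h3 := (hUF _ (hpF k hk) (m.lift ((p k)⁻¹ * γ, j))).trans (mul_le_mul_of_nonneg_left h2 hU)
    have h4 := mul_le_mul h3 h1 (norm_nonneg _) (by have := hA ((p k)⁻¹ * γ); positivity)
    have h5 := mul_le_mul_of_nonneg_left (hgood k hk.le)
      (by positivity : 0 ≤ 27 * (‖m.spike i‖ * (U * ‖m.spike j‖)))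
    rw [hB]
    linarith
  have hsum : |minkowski (m.spike i) (z.1.1 γ *ᵥ m.lift (γ, j))| ≤ n * (B * m.coshDisp γ) := by
    have h1 := m.cocycle_telescope z p hp0 n
    rw [hpn] at h1
    rw [h1, Matrix.sum_mulVec, minkowski_sum]
    refine (Finset.abs_sum_le_sum_abs _ _).trans ((Finset.sum_le_sum hterm).trans (le_of_eq ?_))
    rw [Finset.sum_const, Finset.card_range, nsmul_eq_mul]
  calc _ ≤ _ := hsum
    _ ≤ (C * (1 + Real.log (m.coshDisp γ))) * (B * m.coshDisp γ) :=
      mul_le_mul_of_nonneg_right hn (mul_nonneg hB0 (hA γ).le)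
    _ = _ := by ring

/-- The length of a horoball connection joining `(1, i)` to `(γ, j)`. -/
def lengthAt (i j : ι) (γ : π) : ℝ := Real.log (-minkowski (m.spike i) (m.lift (γ, j)) / 2)

/-- The velocity of the product of the vectors `(1, i)` and `(γ, j)`. -/
def productVelocity (z : m.cocycles) (i j : ι) (γ : π) : ℝ :=
  minkowski (z.1.2 i) (m.lift (γ, j)) + minkowski (m.spike i) (m.liftVelocity z (γ, j))

theorem minkowski_lift_eq (γ δ : π) (i j : ι) : minkowski (m.lift (γ, i)) (m.lift (δ, j)) =
    minkowski (m.spike i) (m.lift (γ⁻¹ * δ, j)) := by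
  rw [minkowski_lift_lift, minkowski_comm]

theorem length_eq_lengthAt (β : HoroballConnection π ι) :
    m.length β = m.lengthAt β.source.2 β.target.2 (β.source.1⁻¹ * β.target.1) := by
  rw [length, lengthAt, ← minkowski_lift_eq]

theorem liftVelocity_mul (z : m.cocycles) (γ δ : π) (j : ι) : m.liftVelocity z (γ * δ, j) =
    z.1.1 γ *ᵥ m.lift (γ * δ, j) + m.holMatrix γ *ᵥ m.liftVelocity z (δ, j) := by
  have h : m.holMatrix γ⁻¹ *ᵥ m.lift (γ * δ, j) = m.lift (δ, j) := by
    rw [← lift_mul, inv_mul_cancel_left]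
  simp only [liftVelocity]
  rw [cocycle_mul, add_mulVec, ← mulVec_mulVec, ← mulVec_mulVec, h, holMatrix_mul, mulVec_add,
    ← mulVec_mulVec, add_assoc]

theorem dlengthCocycle_eq (z : m.cocycles) (β : HoroballConnection π ι) :
    m.dlengthCocycle β z =
      m.productVelocity z β.source.2 β.target.2 (β.source.1⁻¹ * β.target.1) /
        minkowski (m.spike β.source.2) (m.lift (β.source.1⁻¹ * β.target.1, β.target.2)) := by
  obtain ⟨⟨γ, i⟩, ⟨δ, j⟩, hne⟩ := β
  obtain ⟨η, rfl⟩ : ∃ η, δ = γ * η := ⟨γ⁻¹ * δ, (mul_inv_cancel_left γ δ).symm⟩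
  simp only [dlengthCocycle, LinearMap.coe_mk, AddHom.coe_mk, productVelocity]
  rw [minkowski_lift_eq, liftVelocity_mul, inv_mul_cancel_left]
  congr 1
  -- The value of the cocycle at `γ` moves both ends by the same infinitesimal isometry, so its two
  -- contributions cancel.
  have hX := z.2.1 γ (m.lift (γ, i)) (m.lift (γ * η, j))
  have hw : minkowski (m.holMatrix γ *ᵥ z.1.2 i) (m.lift (γ * η, j)) =
      minkowski (z.1.2 i) (m.lift (η, j)) := by rw [lift_mul, minkowski_holMatrix]
  have hv : minkowski (m.lift (γ, i)) (m.holMatrix γ *ᵥ m.liftVelocity z (η, j)) =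
      minkowski (m.spike i) (m.liftVelocity z (η, j)) := by rw [lift, minkowski_holMatrix]
  rw [minkowski_add_right, liftVelocity, minkowski_add_left, hw, hv]
  linarith

theorem exists_productVelocity_bound [Group.FG π] (z : m.cocycles) (i j : ι) : ∃ C : ℝ, 0 ≤ C ∧
    ∀ γ : π, |m.productVelocity z i j γ| ≤
      C * ((1 + Real.log (m.coshDisp γ)) * m.coshDisp γ) := by
  obtain ⟨C, hC, h⟩ := m.exists_cocycle_bound z i j
  refine ⟨C + 9 * (‖z.1.2 i‖ * ‖m.spike j‖) + 9 * (‖m.spike i‖ * ‖z.1.2 j‖), by positivity,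
    fun γ => ?_⟩
  have hA := m.coshDisp_pos γ
  have hlog := Real.log_nonneg (m.one_le_coshDisp γ)
  have h1 := h γ
  have h2 := (abs_minkowski_le (z.1.2 i) (m.lift (γ, j))).trans (mul_le_mul_of_nonneg_left
    (mul_le_mul_of_nonneg_left (m.norm_holMatrix_mulVec_le γ (m.spike j)) (norm_nonneg _))
    (by norm_num : (0 : ℝ) ≤ 3))
  have h3 := (abs_minkowski_le (m.spike i) (m.holMatrix γ *ᵥ z.1.2 j)).trans
    (mul_le_mul_of_nonneg_left (mul_le_mul_of_nonneg_left
      (m.norm_holMatrix_mulVec_le γ (z.1.2 j)) (norm_nonneg _)) (by norm_num : (0 : ℝ) ≤ 3))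
  have h4 : m.coshDisp γ ≤ (1 + Real.log (m.coshDisp γ)) * m.coshDisp γ := by nlinarith
  have h5 := mul_le_mul_of_nonneg_left h4
    (by positivity : 0 ≤ 9 * (‖z.1.2 i‖ * ‖m.spike j‖) + 9 * (‖m.spike i‖ * ‖z.1.2 j‖))
  rw [productVelocity, liftVelocity, minkowski_add_right, ← add_assoc]
  refine (abs_add_three _ _ _).trans ?_
  dsimp only
  linarith

theorem exists_bound_at [Group.FG π] (z : m.cocycles) (i j : ι) : ∃ C : ℝ, ∀ γ : π,
    0 < m.lengthAt i j γ →
    |m.productVelocity z i j γ / minkowski (m.spike i) (m.lift (γ, j))| ≤ C * m.lengthAt i j γ := by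
  obtain ⟨C, hC, hup⟩ := m.exists_productVelocity_bound z i j
  obtain ⟨c, hc, hlow⟩ := m.exists_spike_lower j i
  apply exists_bound_of_eventually (C := 4 * (C / c))
  -- Beyond this threshold `1 + log A` is at most `2 log A`, and the length is at least half of `log
  -- A`; this is the factor `4`.
  have hlogt := (Real.tendsto_log_atTop.comp m.tendsto_coshDisp).eventually_ge_atTop
    (max 1 (-2 * Real.log (c / 2)))
  filter_upwards [hlow, hlogt] with γ h1 h2
  have hA := m.coshDisp_pos γ
  have h3 : 1 ≤ Real.log (m.coshDisp γ) := (le_max_left _ _).trans h2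
  have h4 : -2 * Real.log (c / 2) ≤ Real.log (m.coshDisp γ) := (le_max_right _ _).trans h2
  rw [minkowski_comm] at h1
  have hcA : 0 < c * m.coshDisp γ := mul_pos hc hA
  have h5 : Real.log (c / 2) + Real.log (m.coshDisp γ) ≤ m.lengthAt i j γ := by
    rw [lengthAt, ← Real.log_mul (by positivity) hA.ne']
    exact Real.log_le_log (by positivity) (by linarith)
  have h6 : 1 + Real.log (m.coshDisp γ) ≤ 4 * m.lengthAt i j γ := by linarith
  have h7 : c * m.coshDisp γ ≤ |minkowski (m.spike i) (m.lift (γ, j))| := h1.trans (neg_le_abs _)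
  rw [abs_div, div_le_iff₀ (hcA.trans_le h7)]
  have h8 : 0 ≤ m.lengthAt i j γ := by linarith
  calc |m.productVelocity z i j γ| ≤ C * ((1 + Real.log (m.coshDisp γ)) * m.coshDisp γ) := hup γ
    _ ≤ C * ((4 * m.lengthAt i j γ) * m.coshDisp γ) := by gcongr
    _ = 4 * (C / c) * m.lengthAt i j γ * (c * m.coshDisp γ) := by field_simp
    _ ≤ _ := by gcongr

theorem exists_dlengthCocycle_bound [Group.FG π] (z : m.cocycles) : ∃ C : ℝ,
    ∀ β : HoroballConnection π ι, 0 < m.length β → |m.dlengthCocycle β z| ≤ C * m.length β := by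
  choose C hC using m.exists_bound_at z
  refine ⟨∑ i, ∑ j, |C i j|, fun β hβ => ?_⟩
  have hle : C β.source.2 β.target.2 ≤ ∑ i, ∑ j, |C i j| :=
    (le_abs_self _).trans ((Finset.single_le_sum (f := fun j => |C β.source.2 j|)
      (fun _ _ => abs_nonneg _) (Finset.mem_univ β.target.2)).trans
      (Finset.single_le_sum (f := fun i => ∑ j, |C i j|)
        (fun _ _ => Finset.sum_nonneg fun _ _ => abs_nonneg _) (Finset.mem_univ β.source.2)))
  rw [dlengthCocycle_eq]
  refine le_trans ?_ (mul_le_mul_of_nonneg_right hle hβ.le)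
  rw [length_eq_lengthAt] at hβ ⊢
  exact hC _ _ _ hβ

end DecoratedMetric

end

theorem theorem5p1 {π ι : Type*} [Group π] [IsFreeGroup π] [Group.FG π] [Fintype ι]
    (m : DecoratedMetric π ι)
    (N : Seminorm ℝ m.InfinitesimalDeformation) (hN : ∀ u, N u = 0 → u = 0) :
    ∃ K : ℝ, 0 < K ∧ ∀ (u : m.InfinitesimalDeformation) (β : HoroballConnection π ι),
      0 < m.length β → |m.dlength β u| ≤ K * m.length β * N u := by
  have := m.finiteDimensional_cocycles
  -- The quotient inherits finite dimension from the cocycles, so a constant for each fixed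
  -- deformation suffices.
  refine exists_uniform_bound N hN m.dlength m.length fun u => ?_
  obtain ⟨z, rfl⟩ := Submodule.Quotient.mk_surjective _ u
  exact m.exists_dlengthCocycle_bound z
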